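/- **Setting.** All manifolds and fields are smooth. Let $d\ge 2$ and let $(M_+,g_+)$, $(M_-,g_-)$ be $(d+1)$-dimensional Lorentzian manifolds (signature $(-,+,\dots,+)$). Let $\Sigma_\pm\subset M_\pm$ be embedded timelike hypersurfaces which are the common boundary of the two disjoint open regions $M_\pm^{\rm ex}$ and $M_\pm^{\rm in}$ with $M_\pm=M_\pm^{\rm ex}\sqcup\Sigma_\pm\sqcup M_\pm^{\rm in}$, let $\bar M_\pm=M_\pm\setminus M_\pm^{\rm in}$, and let $\psi:\Sigma_+\to\Sigma_-$ be a diffeomorphism. The joined spacetime $(\mathcal M,g,\Sigma)$ is obtained by gluing $\bar M_+$ to $\bar M_-$ along $\psi$; its shell is $\Sigma=\Sigma_+\equiv\Sigma_-$. Let $N_\pm$ be the unit normal fields of $\Sigma_\pm$, with $N_+$ pointing into $M_+^{\rm ex}$ and $N_-$ pointing into $M_-^{\rm in}$; the gluing identifies $N_+$ with $N_-$. Let $h_\pm$ be the induced metrics, $\chi_\pm$ the second fundamental forms with respect to $N_\pm$, $\chi_\pm(X,Y)=g_\pm(\nabla_XN_\pm,Y)$, and $\theta_\pm=\operatorname{tr}_{h_\pm}\chi_\pm$.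 Put $[A]=A_+-A_-$ on $\Sigma$ (with the identification $\psi$), and $h=\tfrac12(h_++h_-)$. *Einstein equations.* The joined spacetime satisfies the Einstein equations with bulk stress energy tensors $T_\pm$ and surface stress energy tensor $S$ if $\mathrm{Ric}_\pm-\tfrac12R_\pm g_\pm=8\pi T_\pm$ on $\bar M_\pm$, and on $\Sigma$: $[h]=0$; $-\tfrac1{8\pi}([\chi]-[\theta]h)=S$; and $\nabla^h\cdot S+[T(\cdot,N)]=0$. It is *pure-tensional* with tension $\epsilon:\Sigma\to\mathbb R$ (a smooth function) if this holds with $S=-\epsilon h$ and $T_\pm=-\frac{\Lambda_\pm}{8\pi}g_\pm$ for some constants $\Lambda_\pm\in\mathbb R$; it is *pure-tensional* if it is so with some $\epsilon$. *$\mathbb Z_2$-symmetry.* The joined spacetime is $\mathbb Z_2$-symmetric across $\Sigma$ if there is an isometry $\phi:(M_+,g_+)\to(M_-,g_-)$ with $\phi|_{\Sigma_+}=\psi$ and $\phi_*N_+=-N_-$. In that case put $\chi=\chi_+$; $\theta=\operatorname{tr}_h\chi$ is the mean curvature of the shell. *$\Lambda$-vacuum.* $(\bar M_\pm,g_\pm)$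 is $\Lambda$-vacuum if $\mathrm{Ric}_\pm-\tfrac12R_\pm g_\pm+\Lambda g_\pm=0$ on $\bar M_\pm$ for some constant $\Lambda\in\mathbb R$. *Photon surface.* An immersed, nowhere spacelike hypersurface of a spacetime $(M,g)$ is a photon surface if every nonzero null vector $k$ tangent to it is the initial velocity $\dot\gamma(0)$ of a null geodesic $\gamma:(-\varepsilon,\varepsilon)\to M$ of $(M,g)$ whose image lies in the hypersurface. **Theorem 1 (Photon surface as a pure tension shell).** Let $(\mathcal M,g,\Sigma)$ be a joined spacetime constructed from $(M_\pm,g_\pm)$, with $d+1=\dim M_\pm\ge3$, which is $\mathbb Z_2$-symmetric across $\Sigma$. Then $(\mathcal M,g,\Sigma)$ is pure-tensional if and only if $(\bar M_+,g_+)$ and $(\bar M_-,g_-)$ are $\Lambda$-vacuum and $\Sigma_+$, $\Sigma_-$ are photon surfaces of $(M_+,g_+)$, $(M_-,g_-)$. In that case, if $\epsilon$ is the tension, $\epsilon$ and $\theta$ are constant on each connected component of $\Sigma$ (hence constant if $\Sigma$ is connected), and $$\theta=\theta_+=-\theta_-=-4\pi\,\frac{d}{d-1}\,\epsilon .$$ 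-/

import Mathlib

set_option maxSynthPendingDepth 3

open scoped Manifold ContDiff Topology

noncomputable section

/-! ### Linear algebra of bilinear forms -/

namespace BilinForm

variable {V W : Type*} [AddCommGroup V] [Module ℝ V] [TopologicalSpace V]
  [IsTopologicalAddGroup V] [ContinuousSMul ℝ V]
  [AddCommGroup W] [Module ℝ W] [TopologicalSpace W]
  [IsTopologicalAddGroup W] [ContinuousSMul ℝ W]

/-- The form `(v, w) ↦ B (A₁ v) (A₂ w)`. -/
def comp₂ (B : V →L[ℝ] V →L[ℝ] ℝ) (A₁ A₂ : W →L[ℝ] V) : W →L[ℝ] W →L[ℝ] ℝ :=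
  (ContinuousLinearMap.precomp ℝ A₂) ∘L B ∘L A₁

/-- A bilinear form of Lorentzian signature `(-, +, …, +)`: there is a timelike vector on whose
orthogonal complement the form is positive definite. -/
def IsLorentzian (B : V →L[ℝ] V →L[ℝ] ℝ) : Prop :=
  (∀ v w, B v w = B w v) ∧ ∃ t, B t t < 0 ∧ ∀ v, B t v = 0 → v ≠ 0 → 0 < B v v

/-- The trace `G^{ab} B_{ab}` of a bilinear form `B` with respect to a nondegenerate form `G`. -/
def metricTrace (G B : V →L[ℝ] V →L[ℝ] ℝ) : ℝ :=
  LinearMap.trace ℝ V ((G.inverse ∘L B : V →L[ℝ] V) : V →ₗ[ℝ] V)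

end BilinForm

/-! ### Local pseudo-Riemannian geometry

Here `G` is a field of nondegenerate symmetric bilinear forms on (an open subset of) a finite
dimensional vector space `E`, i.e. a metric written in one coordinate chart. -/

namespace LocalGeom

variable {E : Type*} [NormedAddCommGroup E] [NormedSpace ℝ E]

/-- The covectors `w ↦ (∂_u G)(v, w) + (∂_v G)(u, w) - (∂_w G)(u, v)`
(twice the Christoffel symbols of the first kind). -/
def christoffelLower (G : E → E →L[ℝ] E →L[ℝ] ℝ) (x : E) : E →L[ℝ] E →L[ℝ] E →L[ℝ] ℝ :=
  let D : E →L[ℝ] E →L[ℝ] E →L[ℝ] ℝ := fderiv ℝ G x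
  let A : E →L[ℝ] E →L[ℝ] E →L[ℝ] ℝ :=
    (ContinuousLinearMap.flipₗᵢ ℝ E E ℝ).toContinuousLinearEquiv.toContinuousLinearMap ∘L D.flip
  D + D.flip - A

theorem christoffelLower_apply (G : E → E →L[ℝ] E →L[ℝ] ℝ) (x u v w : E) :
    christoffelLower G x u v w
      = fderiv ℝ G x u v w + fderiv ℝ G x v u w - fderiv ℝ G x w u v := rfl

/-- The Christoffel symbols `Γ(u, v)` of the Levi-Civita connection of `G`. -/
def christoffel (G : E → E →L[ℝ] E →L[ℝ] ℝ) (x : E) : E →L[ℝ] E →L[ℝ] E :=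
  (1 / 2 : ℝ) •
    (ContinuousLinearMap.compL ℝ E (E →L[ℝ] ℝ) E (G x).inverse ∘L christoffelLower G x)

theorem christoffel_apply (G : E → E →L[ℝ] E →L[ℝ] ℝ) (x u v : E) :
    christoffel G x u v = (1 / 2 : ℝ) • (G x).inverse (christoffelLower G x u v) := rfl

/-- The curvature `u ↦ R(u, v) w`. -/
def curvature (G : E → E →L[ℝ] E →L[ℝ] ℝ) (x v w : E) : E →L[ℝ] E :=
  let Γ := christoffel G x
  let D := fderiv ℝ (christoffel G) x
  (D.flip v).flip w - (D v).flip w + Γ.flip (Γ v w) - (Γ v) ∘L (Γ.flip w)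

theorem curvature_apply (G : E → E →L[ℝ] E →L[ℝ] ℝ) (x u v w : E) :
    curvature G x v w u
      = fderiv ℝ (christoffel G) x u v w - fderiv ℝ (christoffel G) x v u w
        + christoffel G x u (christoffel G x v w)
        - christoffel G x v (christoffel G x u w) := rfl

/-- The Ricci tensor `Ric(v, w) = tr (u ↦ R(u, v) w)`. -/
def ricci [FiniteDimensional ℝ E] (G : E → E →L[ℝ] E →L[ℝ] ℝ) (x : E) : E →L[ℝ] E →L[ℝ] ℝ :=
  LinearMap.toContinuousBilinearMap <| LinearMap.mk₂ ℝ
    (fun v w => LinearMap.trace ℝ E (curvature G x v w : E →ₗ[ℝ] E))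
    (fun v₁ v₂ w => by
      rw [← map_add]; congr 1; ext u
      simp only [ContinuousLinearMap.coe_coe, LinearMap.add_apply, curvature_apply, map_add,
        _root_.add_apply]
      abel)
    (fun c v w => by
      rw [← map_smul]; congr 1; ext u
      simp only [ContinuousLinearMap.coe_coe, LinearMap.smul_apply, curvature_apply, map_smul,
        _root_.smul_apply, smul_sub, smul_add])
    (fun v w₁ w₂ => by
      rw [← map_add]; congr 1; ext u
      simp only [ContinuousLinearMap.coe_coe, LinearMap.add_apply, curvature_apply, map_add]
      abel)
    (fun c v w => by
      rw [← map_smul]; congr 1; ext u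
      simp only [ContinuousLinearMap.coe_coe, LinearMap.smul_apply, curvature_apply, map_smul,
        smul_sub, smul_add])

theorem ricci_apply [FiniteDimensional ℝ E] (G : E → E →L[ℝ] E →L[ℝ] ℝ) (x v w : E) :
    ricci G x v w = LinearMap.trace ℝ E (curvature G x v w : E →ₗ[ℝ] E) := rfl

/-- The Einstein tensor `Ric - (R / 2) G`. -/
def einstein [FiniteDimensional ℝ E] (G : E → E →L[ℝ] E →L[ℝ] ℝ) (x : E) : E →L[ℝ] E →L[ℝ] ℝ :=
  ricci G x - (BilinForm.metricTrace (G x) (ricci G x) / 2) • G x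

/-- The form `(u, w) ↦ (∇_u T)(a, w)` for a field `T` of bilinear forms. -/
def covDerivForm (G T : E → E →L[ℝ] E →L[ℝ] ℝ) (x a : E) : E →L[ℝ] E →L[ℝ] ℝ :=
  (fderiv ℝ T x).flip a - (T x) ∘L ((christoffel G x).flip a)
    - ContinuousLinearMap.compL ℝ E E ℝ (T x a) ∘L christoffel G x

theorem covDerivForm_apply (G T : E → E →L[ℝ] E →L[ℝ] ℝ) (x a u w : E) :
    covDerivForm G T x a u w
      = fderiv ℝ T x u a w - T x (christoffel G x u a) w - T x a (christoffel G x u w) := rfl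

/-- The divergence `∇^b T_{ab}`. -/
def divergence (G T : E → E →L[ℝ] E →L[ℝ] ℝ) (x a : E) : ℝ :=
  BilinForm.metricTrace (G x) (covDerivForm G T x a)

end LocalGeom

/-! ### Tensor fields on manifolds -/

/-- A (not necessarily smooth) field of bilinear forms on a manifold, i.e. a `(0,2)`-tensor
field. -/
abbrev FormField (E M : Type*) [NormedAddCommGroup E] [NormedSpace ℝ E]
    [TopologicalSpace M] [ChartedSpace E M] :=
  ∀ p : M, TangentSpace 𝓘(ℝ, E) p →L[ℝ] TangentSpace 𝓘(ℝ, E) p →L[ℝ] ℝ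

/-- A smooth Lorentzian metric on `M`. -/
structure LorentzMetric (E M : Type*) [NormedAddCommGroup E] [NormedSpace ℝ E]
    [TopologicalSpace M] [ChartedSpace E M] [IsManifold 𝓘(ℝ, E) ∞ M] where
  /-- the bilinear form on each tangent space -/
  form : FormField E M
  lorentzian : ∀ p, BilinForm.IsLorentzian (form p)
  contMDiff : ContMDiff 𝓘(ℝ, E) (𝓘(ℝ, E).prod 𝓘(ℝ, E →L[ℝ] E →L[ℝ] ℝ)) ∞
    (fun p ↦ Bundle.TotalSpace.mk' (E →L[ℝ] E →L[ℝ] ℝ)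
      (E := fun p ↦ TangentSpace 𝓘(ℝ, E) p →L[ℝ] TangentSpace 𝓘(ℝ, E) p →L[ℝ] ℝ) p (form p))

namespace FormField

variable {E M : Type*} [NormedAddCommGroup E] [NormedSpace ℝ E]
  [TopologicalSpace M] [ChartedSpace E M]

/-- The differential at `q` of the chart at `p`. -/
def dChartAt (E : Type*) {M : Type*} [NormedAddCommGroup E] [NormedSpace ℝ E]
    [TopologicalSpace M] [ChartedSpace E M] (p q : M) : TangentSpace 𝓘(ℝ, E) q →L[ℝ] E :=
  mfderiv 𝓘(ℝ, E) 𝓘(ℝ, E) (extChartAt 𝓘(ℝ, E) p) q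

/-- The differential at `p` of the chart at `p`. -/
def dChart (E : Type*) {M : Type*} [NormedAddCommGroup E] [NormedSpace ℝ E]
    [TopologicalSpace M] [ChartedSpace E M] (p : M) : TangentSpace 𝓘(ℝ, E) p →L[ℝ] E :=
  dChartAt E p p

/-- The differential at `y` of the inverse of the chart at `p`. -/
def dChartSymm (E : Type*) {M : Type*} [NormedAddCommGroup E] [NormedSpace ℝ E]
    [TopologicalSpace M] [ChartedSpace E M] (p : M) (y : E) :
    E →L[ℝ] TangentSpace 𝓘(ℝ, E) ((extChartAt 𝓘(ℝ, E) p).symm y) :=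
  mfderiv 𝓘(ℝ, E) 𝓘(ℝ, E) (extChartAt 𝓘(ℝ, E) p).symm y

/-- The differential at `s` of a function with values in a vector space. -/
def dVec {E F S : Type*} [NormedAddCommGroup E] [NormedSpace ℝ E]
    [NormedAddCommGroup F] [NormedSpace ℝ F] [TopologicalSpace S] [ChartedSpace F S]
    (f : S → E) (s : S) : TangentSpace 𝓘(ℝ, F) s →L[ℝ] E :=
  mfderiv 𝓘(ℝ, F) 𝓘(ℝ, E) f s

/-- The coordinate expression of a field of bilinear forms in the chart at `p`. -/
def inChart (B : FormField E M) (p : M) (y : E) : E →L[ℝ] E →L[ℝ] ℝ :=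
  BilinForm.comp₂ (B ((extChartAt 𝓘(ℝ, E) p).symm y)) (dChartSymm E p y) (dChartSymm E p y)

/-- The Einstein tensor of the metric `g`, computed at `p` in the chart at `p`. -/
def einsteinTensor [FiniteDimensional ℝ E] (g : FormField E M) : FormField E M := fun p ↦
  BilinForm.comp₂ (LocalGeom.einstein (g.inChart p) (extChartAt 𝓘(ℝ, E) p p))
    (dChart E p) (dChart E p)

/-- The divergence `∇^b T_{ab}` of the tensor field `T` with respect to the metric `g`,
computed at `p` in the chart at `p`. -/
def divergence (g T : FormField E M) (p : M) (a : TangentSpace 𝓘(ℝ, E) p) : ℝ :=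
  LocalGeom.divergence (g.inChart p) (T.inChart p) (extChartAt 𝓘(ℝ, E) p p) (dChart E p a)

variable {F S : Type*} [NormedAddCommGroup F] [NormedSpace ℝ F]
  [TopologicalSpace S] [ChartedSpace F S]

/-- The pullback of a field of bilinear forms along a map; for a metric and an immersion, the
induced metric. -/
def pullback (B : FormField E M) (f : S → M) : FormField F S := fun s ↦
  BilinForm.comp₂ (B (f s)) (mfderiv 𝓘(ℝ, F) 𝓘(ℝ, E) f s) (mfderiv 𝓘(ℝ, F) 𝓘(ℝ, E) f s)

/-- The Levi-Civita covariant derivative `v ↦ ∇_v X` at `s` of a vector field `X` along a map `f`.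
In the chart `φ` at `f s` it is `v ↦ ∂_v (dφ X) + Γ(d(φ ∘ f) v, dφ X)`. -/
def covDerivAlong (g : FormField E M) (f : S → M) (X : ∀ s, TangentSpace 𝓘(ℝ, E) (f s)) (s : S) :
    TangentSpace 𝓘(ℝ, F) s →L[ℝ] TangentSpace 𝓘(ℝ, E) (f s) :=
  let φ := extChartAt 𝓘(ℝ, E) (f s)
  let Xφ : S → E := fun s' ↦ dChartAt E (f s) (f s') (X s')
  (dChart E (f s)).inverse ∘L
    (dVec Xφ s +
      ((LocalGeom.christoffel (g.inChart (f s)) (φ (f s))).flip (Xφ s)) ∘L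
        dVec (fun s' ↦ φ (f s')) s)

/-- The second fundamental form `χ(v, w) = (∇n)(v, w) = g(∇_v N, w)` of an immersed hypersurface
`f` with respect to the unit normal field `N`. -/
def secondFundamentalForm (g : FormField E M) (f : S → M)
    (N : ∀ s, TangentSpace 𝓘(ℝ, E) (f s)) : FormField F S := fun s ↦
  (ContinuousLinearMap.precomp ℝ (mfderiv 𝓘(ℝ, F) 𝓘(ℝ, E) f s)) ∘L g (f s) ∘L
    g.covDerivAlong f N s

theorem pullback_apply (B : FormField E M) (f : S → M) (s : S) (v w : TangentSpace 𝓘(ℝ, F) s) :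
    B.pullback f s v w
      = B (f s) (mfderiv 𝓘(ℝ, F) 𝓘(ℝ, E) f s v) (mfderiv 𝓘(ℝ, F) 𝓘(ℝ, E) f s w) := rfl

end FormField

/-! ### Hypersurfaces, vacuum, photon surfaces -/

section

variable {E M F S : Type*} [NormedAddCommGroup E] [NormedSpace ℝ E]
  [TopologicalSpace M] [ChartedSpace E M]
  [NormedAddCommGroup F] [NormedSpace ℝ F]
  [TopologicalSpace S] [ChartedSpace F S]

/-- The metric `g` satisfies the Einstein equation `G = 8π T` (with any cosmological term absorbed
in `T`) at the points of `U`. -/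
def EinsteinEquationOn [FiniteDimensional ℝ E] (g T : FormField E M) (U : Set M) : Prop :=
  ∀ p ∈ U, g.einsteinTensor p = (8 * Real.pi) • T p

/-- `(U, g)` is `Λ`-vacuum: `Ric - (R / 2) g + Λ g = 0` for some constant `Λ`. -/
def IsLambdaVacuumOn [FiniteDimensional ℝ E] (g : FormField E M) (U : Set M) : Prop :=
  ∃ Λ : ℝ, ∀ p ∈ U, g.einsteinTensor p + Λ • g p = 0

/-- The velocity of a curve. -/
def velocity (E : Type*) {M : Type*} [NormedAddCommGroup E] [NormedSpace ℝ E]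
    [TopologicalSpace M] [ChartedSpace E M] (γ : ℝ → M) (t : ℝ) : TangentSpace 𝓘(ℝ, E) (γ t) :=
  mfderiv 𝓘(ℝ, ℝ) 𝓘(ℝ, E) γ t (1 : ℝ)

/-- `γ` restricted to `(-ε, ε)` is a null geodesic of `(M, g)`. -/
structure IsNullGeodesicOn (g : FormField E M) (γ : ℝ → M) (ε : ℝ) : Prop where
  smooth : ContMDiffOn 𝓘(ℝ, ℝ) 𝓘(ℝ, E) ∞ γ (Set.Ioo (-ε) ε)
  geodesic : ∀ t ∈ Set.Ioo (-ε) ε,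
    g.covDerivAlong (F := ℝ) γ (velocity E γ) t (1 : ℝ) = 0
  null : ∀ t ∈ Set.Ioo (-ε) ε, g (γ t) (velocity E γ t) (velocity E γ t) = 0

/-- The immersed hypersurface `ι : S → M` is a photon surface of `(M, g)`: it is nowhere spacelike,
and every null vector `k` tangent to it is the initial velocity of a null geodesic of `(M, g)`
defined on some `(-ε, ε)` and contained in the image of `ι`. -/
structure IsPhotonSurface (g : FormField E M) (ι : S → M) : Prop where
  immersion : Manifold.IsImmersion 𝓘(ℝ, F) 𝓘(ℝ, E) ∞ ι
  codim : Module.finrank ℝ E = Module.finrank ℝ F + 1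
  nowhere_spacelike : ∀ s, ∃ v : TangentSpace 𝓘(ℝ, F) s, v ≠ 0 ∧ g.pullback (F := F) ι s v v ≤ 0
  null_geodesics : ∀ (s : S) (k : TangentSpace 𝓘(ℝ, F) s), k ≠ 0 → g.pullback (F := F) ι s k k = 0 →
    ∃ ε > 0, ∃ γ : ℝ → M, IsNullGeodesicOn g γ ε ∧
      (⟨γ 0, velocity E γ 0⟩ : TangentBundle 𝓘(ℝ, E) M)
        = ⟨ι s, mfderiv 𝓘(ℝ, F) 𝓘(ℝ, E) ι s k⟩ ∧
      ∀ t ∈ Set.Ioo (-ε) ε, γ t ∈ Set.range ι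

/-- The tangent vector `v` at `p` points into `U`. -/
def PointsInto (p : M) (v : TangentSpace 𝓘(ℝ, E) p) (U : Set M) : Prop :=
  ∀ᶠ t : ℝ in 𝓝[>] 0, (extChartAt 𝓘(ℝ, E) p).symm
    (extChartAt 𝓘(ℝ, E) p p + t • FormField.dChart E p v) ∈ U

end

/-- An embedded timelike hypersurface `Σ = ι(S)` partitioning `(M, g)` into two open regions `back`
and `front` with common boundary `Σ`, together with its smooth unit normal field `N`, which points
into `front`. -/
structure TimelikeWall {E M : Type*} [NormedAddCommGroup E] [NormedSpace ℝ E]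
    [TopologicalSpace M] [ChartedSpace E M] [IsManifold 𝓘(ℝ, E) ∞ M] (g : LorentzMetric E M)
    (F S : Type*) [NormedAddCommGroup F] [NormedSpace ℝ F]
    [TopologicalSpace S] [ChartedSpace F S] where
  /-- the embedding -/
  ι : S → M
  embedding : Manifold.IsSmoothEmbedding 𝓘(ℝ, F) 𝓘(ℝ, E) ∞ ι
  codim : Module.finrank ℝ E = Module.finrank ℝ F + 1
  timelike : ∀ s, BilinForm.IsLorentzian (g.form.pullback (F := F) ι s)
  /-- the region behind the hypersurface -/
  back : Set M
  /-- the region in front of the hypersurface -/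
  front : Set M
  isOpen_back : IsOpen back
  isOpen_front : IsOpen front
  disjoint : Disjoint back front
  compl_union : (back ∪ front)ᶜ = Set.range ι
  frontier_back : frontier back = Set.range ι
  frontier_front : frontier front = Set.range ι
  /-- the unit normal field -/
  N : ∀ s, TangentSpace 𝓘(ℝ, E) (ι s)
  smooth_N : ContMDiff 𝓘(ℝ, F) 𝓘(ℝ, E).tangent ∞
    (fun s ↦ (⟨ι s, N s⟩ : TangentBundle 𝓘(ℝ, E) M))
  normal_N : ∀ s (v : TangentSpace 𝓘(ℝ, F) s),
    g.form (ι s) (N s) (mfderiv 𝓘(ℝ, F) 𝓘(ℝ, E) ι s v) = 0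
  unit_N : ∀ s, g.form (ι s) (N s) (N s) = 1
  N_into_front : ∀ s, PointsInto (ι s) (N s) front

/-! ### Joined spacetimes -/

/-- A joined spacetime constructed from `(M₊, g₊)` and `(M₋, g₋)`. Its shell is the manifold `S`,
embedded as `Σ₊ = plus.ι(S)` and `Σ₋ = minus.ι(S)`; the identification `ψ : Σ₊ → Σ₋` is
`plus.ι s ↦ minus.ι s`, and `ψ_N : N₊ ↦ N₋`. The normal `N₊` points into the exterior
`M₊^ex = plus.front`, and `N₋` points into the interior `M₋^in = minus.front`. -/
structure JoinedSpacetime {E Mp Mm : Type*} [NormedAddCommGroup E] [NormedSpace ℝ E]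
    [TopologicalSpace Mp] [ChartedSpace E Mp] [IsManifold 𝓘(ℝ, E) ∞ Mp]
    [TopologicalSpace Mm] [ChartedSpace E Mm] [IsManifold 𝓘(ℝ, E) ∞ Mm]
    (gp : LorentzMetric E Mp) (gm : LorentzMetric E Mm)
    (F S : Type*) [NormedAddCommGroup F] [NormedSpace ℝ F]
    [TopologicalSpace S] [ChartedSpace F S] where
  /-- the hypersurface `Σ₊` in `M₊` -/
  plus : TimelikeWall gp F S
  /-- the hypersurface `Σ₋` in `M₋` -/
  minus : TimelikeWall gm F S

namespace JoinedSpacetime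

variable {E Mp Mm F S : Type*} [NormedAddCommGroup E] [NormedSpace ℝ E]
  [TopologicalSpace Mp] [ChartedSpace E Mp] [IsManifold 𝓘(ℝ, E) ∞ Mp]
  [TopologicalSpace Mm] [ChartedSpace E Mm] [IsManifold 𝓘(ℝ, E) ∞ Mm]
  {gp : LorentzMetric E Mp} {gm : LorentzMetric E Mm}
  [NormedAddCommGroup F] [NormedSpace ℝ F] [TopologicalSpace S] [ChartedSpace F S]
  (J : JoinedSpacetime gp gm F S)

/-- The truncated manifold `M̄₊ = M₊ \ M₊^in`, with boundary `Σ₊`. -/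
def barPlus : Set Mp := J.plus.backᶜ

/-- The truncated manifold `M̄₋ = M₋ \ M₋^in`, with boundary `Σ₋`. -/
def barMinus : Set Mm := J.minus.frontᶜ

/-- The underlying space of the joined manifold `M̄₊ ∪ M̄₋`: the disjoint union of the truncated
manifolds with `Σ₊` and `Σ₋` identified by `ψ`. -/
def Glued : Type _ :=
  Quot fun x y : J.barPlus ⊕ J.barMinus ↦
    ∃ (s : S) (hp : J.plus.ι s ∈ J.barPlus) (hm : J.minus.ι s ∈ J.barMinus),
      x = Sum.inl ⟨J.plus.ι s, hp⟩ ∧ y = Sum.inr ⟨J.minus.ι s, hm⟩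

instance : TopologicalSpace J.Glued :=
  inferInstanceAs (TopologicalSpace (Quot _))

/-- The induced metric `h₊` of `Σ₊`, as a tensor field on the shell. -/
def hPlus : FormField F S := gp.form.pullback J.plus.ι

/-- The induced metric `h₋` of `Σ₋`, as a tensor field on the shell. -/
def hMinus : FormField F S := gm.form.pullback J.minus.ι

/-- The second fundamental form `χ₊` of `Σ₊` with respect to `N₊`. -/
def chiPlus : FormField F S := gp.form.secondFundamentalForm J.plus.ι J.plus.N

/-- The second fundamental form `χ₋` of `Σ₋` with respect to `N₋`. -/
def chiMinus : FormField F S := gm.form.secondFundamentalForm J.minus.ι J.minus.N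

/-- The trace `θ₊` of `χ₊`. -/
def thetaPlus (s : S) : ℝ := BilinForm.metricTrace (J.hPlus s) (J.chiPlus s)

/-- The trace `θ₋` of `χ₋`. -/
def thetaMinus (s : S) : ℝ := BilinForm.metricTrace (J.hMinus s) (J.chiMinus s)

/-- The metric of the shell, induced from `g = Θ(l) g₊ + Θ(-l) g₋` with `Θ(0) = 1 / 2`. -/
def shellMetric : FormField F S := fun s ↦ (1 / 2 : ℝ) • (J.hPlus s + J.hMinus s)

/-- The mean curvature of the shell: the trace of `χ = χ₊` with respect to the metric of the
shell. -/
def shellMeanCurvature (s : S) : ℝ := BilinForm.metricTrace (J.shellMetric s) (J.chiPlus s)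

/-- The joined spacetime satisfies the Einstein equations with bulk stress energy tensors `T₊`, `T₋`
and surface stress energy tensor `Sur`: the Einstein equation on `M̄₊` and `M̄₋`, the first and second
junction conditions and the equation of motion `∇^h · Sur + [T_N] = 0` of the shell. -/
structure SatisfiesEinstein [FiniteDimensional ℝ E]
    (Tp : FormField E Mp) (Tm : FormField E Mm) (Sur : FormField F S) : Prop where
  bulk_plus : EinsteinEquationOn gp.form Tp J.barPlus
  bulk_minus : EinsteinEquationOn gm.form Tm J.barMinus
  first_junction : ∀ s, J.hPlus s - J.hMinus s = 0
  second_junction : ∀ s,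
    -(1 / (8 * Real.pi)) • ((J.chiPlus s - J.chiMinus s)
      - (J.thetaPlus s - J.thetaMinus s) • J.shellMetric s) = Sur s
  shell_motion : ∀ s (a : TangentSpace 𝓘(ℝ, F) s),
    J.shellMetric.divergence Sur s a
      + (Tp (J.plus.ι s) (mfderiv 𝓘(ℝ, F) 𝓘(ℝ, E) J.plus.ι s a) (J.plus.N s)
        - Tm (J.minus.ι s) (mfderiv 𝓘(ℝ, F) 𝓘(ℝ, E) J.minus.ι s a) (J.minus.N s)) = 0

/-- The joined spacetime is pure-tensional with (smooth) tension `ε`. -/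
def IsPureTensionalWith [FiniteDimensional ℝ E] (ε : S → ℝ) : Prop :=
  ContMDiff 𝓘(ℝ, F) 𝓘(ℝ, ℝ) ∞ ε ∧ ∃ Λp Λm : ℝ,
    J.SatisfiesEinstein (fun p ↦ -(Λp / (8 * Real.pi)) • gp.form p)
      (fun p ↦ -(Λm / (8 * Real.pi)) • gm.form p) (fun s ↦ -ε s • J.shellMetric s)

/-- The joined spacetime is pure-tensional. -/
def IsPureTensional [FiniteDimensional ℝ E] : Prop := ∃ ε : S → ℝ, J.IsPureTensionalWith ε

/-- The joined spacetime is `Z₂`-symmetric across its shell: there is an isometry `φ` from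
`(M₊, g₊)` onto `(M₋, g₋)` with `φ|Σ₊ = ψ` and `φ_* N₊ = -N₋`. -/
def IsZ2Symmetric : Prop :=
  ∃ φ : Mp ≃ₘ^∞⟮𝓘(ℝ, E), 𝓘(ℝ, E)⟯ Mm,
    (∀ p, gm.form.pullback φ p = gp.form p) ∧
    (∀ s, φ (J.plus.ι s) = J.minus.ι s) ∧
    ∀ s, tangentMap 𝓘(ℝ, E) 𝓘(ℝ, E) φ ⟨J.plus.ι s, J.plus.N s⟩
      = (⟨J.minus.ι s, -J.minus.N s⟩ : TangentBundle 𝓘(ℝ, E) Mm)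

end JoinedSpacetime

end

/-!
The reflection is an isometry that maps `N₊` to `-N₋`, so `h₊ = h₋` and `χ₋ = -χ₊`
(`IsZ2Symmetric.hPlus_eq_and_chiPlus_eq`). The first junction condition then always holds, and the
jumps in the second one are `[χ] = 2χ₊` and `[θ] = 2θ₊`. With `S = -ε h` it becomes
`χ₊ = (θ₊ + 4πε) h` (`IsZ2Symmetric.second_junction_iff`): the shell is umbilic, and the trace
`θ₊ = d (θ₊ + 4πε)` gives the value of the mean curvature. In the bulk, `T = -Λ/(8π) g` is the
`Λ`-vacuum equation, and since `g(·, N)` vanishes on the shell, the equation of motion reduces to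
`dε = 0` (`IsZ2Symmetric.shell_motion_iff`).

It remains to see that a timelike hypersurface is umbilic if and only if it is a photon surface, and
that `ε`, a multiple of the umbilic factor `lam`, is locally constant in vacuum.

* If the hypersurface is a photon surface, then `χ(k, k)` is, up to sign, the normal acceleration of
  the null geodesic with initial velocity `k`, so `χ` vanishes on the light cone of `h`
  (`TimelikeWall.chi_eq_zero_of_isPhotonSurface`), and a symmetric form with this property is a
  multiple of `h` (`BilinForm.IsLorentzian.exists_eq_smul`).
* If `χ = lam h`, the geodesic of the induced metric with null initial velocity stays null, and its
  ambient acceleration `-χ(c', c') N = -lam h(c', c') N` vanishes, so it is a null geodesic of the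
  spacetime (`TimelikeWall.isPhotonSurface_of_umbilic`). It is found by integrating the geodesic
  spray of the hypersurface, written in terms of the ambient connection, so that the Levi-Civita
  connection of `h` is not needed.
* If `χ = lam h`, the contracted Codazzi equation is `Ric(X, N) = (1 - d) dlam(X)`
  (`LocalGeom.LocalHypersurface.ricci_normal_of_umbilic`). In vacuum the left side is a multiple of
  `g(X, N) = 0`, whence `dlam = 0` because `d ≠ 1` (`TimelikeWall.fderiv_eq_zero_of_umbilic`).

All this is local, and is proved for maps between vector spaces, with
`LocalGeom.LocalHypersurface` as the coordinate model of a hypersurface. The notions on manifolds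
are defined pointwise in the preferred chart at each point; `FormField.dVec_covDerivAlong` shows
that the covariant derivative along a map may be computed in any coordinates. It serves to compare
the charts at neighbouring points, and to transport the second fundamental form along the reflection.
-/

noncomputable section

/-! ### The Levi-Civita connection in coordinates -/

namespace LocalGeom

variable {E F : Type*} [NormedAddCommGroup E] [NormedSpace ℝ E]
  [NormedAddCommGroup F] [NormedSpace ℝ F]

theorem minSmoothness_two_le_infty : minSmoothness ℝ 2 ≤ (∞ : WithTop ℕ∞) := by
  rw [minSmoothness_of_isRCLikeNormedField]
  exact WithTop.coe_le_coe.2 (le_top (a := (2 : ℕ∞)))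

/-- `G` is a smooth pseudo-Riemannian metric on the open set `V`, of any signature. -/
structure IsMetricOn (G : E → E →L[ℝ] E →L[ℝ] ℝ) (V : Set E) : Prop where
  isOpen : IsOpen V
  contDiffOn : ContDiffOn ℝ ∞ G V
  symm : ∀ y ∈ V, ∀ u v, G y u v = G y v u
  nondegenerate : ∀ y ∈ V, (G y).IsInvertible

/-- The covariant derivative `v ↦ ∂_v X + Γ(∂_v c, X)` of a vector field `X` along a map `c` into a
coordinate domain. -/
def alongDeriv (G : E → E →L[ℝ] E →L[ℝ] ℝ) (c X : F → E) (x : F) : F →L[ℝ] E :=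
  fderiv ℝ X x + ((christoffel G (c x)).flip (X x)) ∘L fderiv ℝ c x

theorem alongDeriv_apply (G : E → E →L[ℝ] E →L[ℝ] ℝ) (c X : F → E) (x v : F) :
    alongDeriv G c X x v = fderiv ℝ X x v + christoffel G (c x) (fderiv ℝ c x v) (X x) := rfl

namespace IsMetricOn

variable {G : E → E →L[ℝ] E →L[ℝ] ℝ} {V : Set E} (hG : IsMetricOn G V)
include hG

theorem contDiffAt {y : E} (hy : y ∈ V) : ContDiffAt ℝ ∞ G y :=
  hG.contDiffOn.contDiffAt (hG.isOpen.mem_nhds hy)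

theorem differentiableAt {y : E} (hy : y ∈ V) : DifferentiableAt ℝ G y :=
  (hG.contDiffAt hy).differentiableAt (by simp)

theorem eq_of_forall {y : E} (hy : y ∈ V) {a b : E} (h : ∀ w, G y a w = G y b w) : a = b :=
  (hG.nondegenerate y hy).injective (ContinuousLinearMap.ext h)

theorem hasFDerivAt_apply {y : E} (hy : y ∈ V) {c X Y : F → E} {x : F}
    {c' X' Y' : F →L[ℝ] E} (hcx : c x = y) (hc : HasFDerivAt c c' x) (hX : HasFDerivAt X X' x)
    (hY : HasFDerivAt Y Y' x) (v : F) :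
    fderiv ℝ (fun z ↦ G (c z) (X z) (Y z)) x v
      = fderiv ℝ G y (c' v) (X x) (Y x) + G y (X' v) (Y x) + G y (X x) (Y' v) := by
  subst hcx
  have h1 : HasFDerivAt (fun z ↦ G (c z)) ((fderiv ℝ G (c x)) ∘L c') x :=
    (hG.differentiableAt hy).hasFDerivAt.comp x hc
  have h2 := (h1.clm_apply hX).clm_apply hY
  rw [h2.fderiv]
  simp
  ring

theorem fderiv_symm {y : E} (hy : y ∈ V) (u v w : E) :
    fderiv ℝ G y u v w = fderiv ℝ G y u w v := by
  have h1 := hG.hasFDerivAt_apply (c := fun z ↦ z) (X := fun _ ↦ v) (Y := fun _ ↦ w) hy rfl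
    (hasFDerivAt_id y) (hasFDerivAt_const _ _) (hasFDerivAt_const _ _) u
  have h2 := hG.hasFDerivAt_apply (c := fun z ↦ z) (X := fun _ ↦ w) (Y := fun _ ↦ v) hy rfl
    (hasFDerivAt_id y) (hasFDerivAt_const _ _) (hasFDerivAt_const _ _) u
  have h3 : (fun z ↦ G z v w) =ᶠ[𝓝 y] fun z ↦ G z w v := by
    filter_upwards [hG.isOpen.mem_nhds hy] with z hz using hG.symm z hz v w
  rw [h3.fderiv_eq] at h1
  simp at h1 h2
  rw [← h1, h2]

theorem apply_christoffel {y : E} (hy : y ∈ V) (u v w : E) :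
    G y (christoffel G y u v) w = 1 / 2 * christoffelLower G y u v w := by
  rw [christoffel_apply, map_smul, (hG.nondegenerate y hy).self_apply_inverse]
  simp

theorem christoffel_symm {y : E} (hy : y ∈ V) (u v : E) :
    christoffel G y u v = christoffel G y v u := by
  refine hG.eq_of_forall hy fun w ↦ ?_
  rw [hG.apply_christoffel hy, hG.apply_christoffel hy, christoffelLower_apply,
    christoffelLower_apply, hG.fderiv_symm hy w u v]
  ring

theorem fderiv_eq {y : E} (hy : y ∈ V) (u v w : E) :
    fderiv ℝ G y u v w = G y (christoffel G y u v) w + G y v (christoffel G y u w) := by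
  rw [hG.symm y hy v, hG.apply_christoffel hy, hG.apply_christoffel hy, christoffelLower_apply,
    christoffelLower_apply, hG.fderiv_symm hy u w v, hG.fderiv_symm hy v u w,
    hG.fderiv_symm hy w u v]
  ring

/-- The Levi-Civita connection is metric. -/
theorem fderiv_apply_eq {c X Y : F → E} {x : F} (hx : c x ∈ V) (hc : DifferentiableAt ℝ c x)
    (hX : DifferentiableAt ℝ X x) (hY : DifferentiableAt ℝ Y x) (v : F) :
    fderiv ℝ (fun z ↦ G (c z) (X z) (Y z)) x v
      = G (c x) (alongDeriv G c X x v) (Y x) + G (c x) (X x) (alongDeriv G c Y x v) := by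
  rw [hG.hasFDerivAt_apply hx rfl hc.hasFDerivAt hX.hasFDerivAt hY.hasFDerivAt,
    hG.fderiv_eq hx, alongDeriv_apply, alongDeriv_apply]
  simp
  ring

variable [FiniteDimensional ℝ E]

theorem contDiffAt_christoffel {y : E} (hy : y ∈ V) : ContDiffAt ℝ ∞ (christoffel G) y := by
  have h1 : ContDiffAt ℝ ∞ (fun z ↦ (G z).inverse) y :=
    ContDiffAt.comp y (hG.nondegenerate y hy).contDiffAt_map_inverse (hG.contDiffAt hy)
  have h2 : ContDiffAt ℝ ∞ (fderiv ℝ G) y := (hG.contDiffAt hy).fderiv_right (by simp)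
  have h3 : ContDiffAt ℝ ∞ (christoffelLower G) y := by
    unfold christoffelLower
    have h4 : ContDiffAt ℝ ∞ (fun z ↦ (fderiv ℝ G z).flip) y :=
      (ContinuousLinearMap.flipₗᵢ ℝ E E (E →L[ℝ] ℝ)).contDiff.contDiffAt.comp y h2
    exact (h2.add h4).sub (contDiffAt_const.clm_comp h4)
  have h5 : ContDiffAt ℝ ∞ (fun z ↦ ContinuousLinearMap.compL ℝ E (E →L[ℝ] ℝ) E (G z).inverse) y :=
    (ContinuousLinearMap.compL ℝ E (E →L[ℝ] ℝ) E).contDiff.contDiffAt.comp y h1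
  exact (contDiffAt_const (c := (1 / 2 : ℝ))).smul (h5.clm_comp h3)

theorem differentiableAt_christoffel {y : E} (hy : y ∈ V) :
    DifferentiableAt ℝ (christoffel G) y :=
  (hG.contDiffAt_christoffel hy).differentiableAt (by simp)

theorem contDiffAt_alongDeriv {c X : F → E} {x : F} (hx : c x ∈ V) (hc : ContDiffAt ℝ ∞ c x)
    (hX : ContDiffAt ℝ ∞ X x) : ContDiffAt ℝ ∞ (alongDeriv G c X) x := by
  have h1 : ContDiffAt ℝ ∞ (fun z ↦ (christoffel G (c z)).flip) x :=
    (ContinuousLinearMap.flipₗᵢ ℝ E E E).contDiff.contDiffAt.comp x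
      ((hG.contDiffAt_christoffel hx).comp x hc)
  exact (hX.fderiv_right (by simp)).add
    ((h1.clm_apply hX).clm_comp (hc.fderiv_right (by simp)))

/-- The curvature is the commutator of covariant derivatives along a map. -/
theorem alongDeriv_alongDeriv_sub {c X : F → E} {x : F} (hx : c x ∈ V)
    (hc : ContDiffAt ℝ ∞ c x) (hX : ContDiffAt ℝ ∞ X x) (u v : F) :
    alongDeriv G c (fun z ↦ alongDeriv G c X z v) x u
      - alongDeriv G c (fun z ↦ alongDeriv G c X z u) x v
      = curvature G (c x) (fderiv ℝ c x v) (X x) (fderiv ℝ c x u) := by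
  have hXd := (hX.differentiableAt (by simp)).hasFDerivAt
  have hcd := (hc.differentiableAt (by simp)).hasFDerivAt
  have hX2 := ((hX.fderiv_right (m := ∞) (by simp)).differentiableAt (by simp)).hasFDerivAt
  have hc2 := ((hc.fderiv_right (m := ∞) (by simp)).differentiableAt (by simp)).hasFDerivAt
  have hΓ := (hG.differentiableAt_christoffel hx).hasFDerivAt.comp x hcd
  have key : ∀ u v, fderiv ℝ (fun z ↦ alongDeriv G c X z v) x u
      = fderiv ℝ (fderiv ℝ X) x u v
        + fderiv ℝ (christoffel G) (c x) (fderiv ℝ c x u) (fderiv ℝ c x v) (X x)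
        + christoffel G (c x) (fderiv ℝ (fderiv ℝ c) x u v) (X x)
        + christoffel G (c x) (fderiv ℝ c x v) (fderiv ℝ X x u) := by
    intro u v
    have h := (hX2.clm_apply (hasFDerivAt_const v x)).add
      ((hΓ.clm_apply (hc2.clm_apply (hasFDerivAt_const v x))).clm_apply hXd)
    have h' : fderiv ℝ (fun z ↦ alongDeriv G c X z v) x = _ := h.fderiv
    rw [h']
    simp
    abel
  have sX := (hX.isSymmSndFDerivAt minSmoothness_two_le_infty).eq u v
  have sc := (hc.isSymmSndFDerivAt minSmoothness_two_le_infty).eq u v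
  rw [alongDeriv_apply G c (fun z ↦ alongDeriv G c X z v),
    alongDeriv_apply G c (fun z ↦ alongDeriv G c X z u), key, key, curvature_apply,
    alongDeriv_apply, alongDeriv_apply, sX, sc]
  simp only [map_add]
  abel

/-- The curvature `R(u, v)` is skew with respect to the metric. -/
theorem curvature_skew {y : E} (hy : y ∈ V) (u v w : E) : G y (curvature G y v w u) w = 0 := by
  -- the Hessian of the function `G(w, w)`, for a constant field `w`, is symmetric
  have hid : ContDiffAt ℝ ∞ (fun z : E ↦ z) y := contDiffAt_id
  have hw : ContDiffAt ℝ ∞ (fun _ : E ↦ w) y := contDiffAt_const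
  have hdw : ∀ u, DifferentiableAt ℝ (fun z ↦ alongDeriv G (fun z ↦ z) (fun _ ↦ w) z u) y :=
    fun u ↦ ((hG.contDiffAt_alongDeriv hy hid hw).clm_apply contDiffAt_const).differentiableAt
      (by simp)
  have hq : ContDiffAt ℝ ∞ (fun z ↦ G z w w) y :=
    ((hG.contDiffAt hy).clm_apply hw).clm_apply hw
  have key : ∀ u v, fderiv ℝ (fderiv ℝ (fun z ↦ G z w w)) y u v
      = 2 * (G y (alongDeriv G (fun z ↦ z)
          (fun z ↦ alongDeriv G (fun z ↦ z) (fun _ ↦ w) z v) y u) w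
        + G y (alongDeriv G (fun z ↦ z) (fun _ ↦ w) y v)
          (alongDeriv G (fun z ↦ z) (fun _ ↦ w) y u)) := by
    intro u v
    have hev : (fun z ↦ fderiv ℝ (fun z ↦ G z w w) z v) =ᶠ[𝓝 y]
        fun z ↦ 2 * G z (alongDeriv G (fun z ↦ z) (fun _ ↦ w) z v) w := by
      filter_upwards [hG.isOpen.mem_nhds hy] with z hz
      rw [hG.fderiv_apply_eq (c := fun z ↦ z) (X := fun _ ↦ w) (Y := fun _ ↦ w) hz
        differentiableAt_id (differentiableAt_const _) (differentiableAt_const _), hG.symm z hz w]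
      ring
    have h1 : fderiv ℝ (fderiv ℝ (fun z ↦ G z w w)) y u v
        = fderiv ℝ (fun z ↦ fderiv ℝ (fun z ↦ G z w w) z v) y u := by
      have := ((hq.fderiv_right (m := ∞) (by simp)).differentiableAt
        (by simp)).hasFDerivAt.clm_apply (hasFDerivAt_const v y)
      rw [this.fderiv]
      simp
    have hd : DifferentiableAt ℝ (fun z ↦ G z (alongDeriv G (fun z ↦ z) (fun _ ↦ w) z v) w) y :=
      ((hG.differentiableAt hy).clm_apply (hdw v)).clm_apply (differentiableAt_const _)
    rw [h1, hev.fderiv_eq, fderiv_const_mul hd, smul_apply,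
      hG.fderiv_apply_eq (c := fun z ↦ z) (Y := fun _ ↦ w) hy differentiableAt_id (hdw v)
        (differentiableAt_const _), smul_eq_mul]
  have hs := (hq.isSymmSndFDerivAt minSmoothness_two_le_infty).eq u v
  rw [key, key] at hs
  have hR := hG.alongDeriv_alongDeriv_sub (c := fun z ↦ z) (X := fun _ ↦ w) hy hid hw u v
  simp only [fderiv_fun_id, ContinuousLinearMap.id_apply] at hR
  rw [← hR, map_sub, sub_apply]
  have := hG.symm y hy (alongDeriv G (fun z ↦ z) (fun _ ↦ w) y u)
    (alongDeriv G (fun z ↦ z) (fun _ ↦ w) y v)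
  linarith

end IsMetricOn

/-- Transformation law of the Christoffel symbols: if `G` is the pullback of `G'` along `Ψ`, then
`Ψ` intertwines the two connections up to the second derivative of `Ψ`. -/
theorem fderiv_christoffel {G : E → E →L[ℝ] E →L[ℝ] ℝ} {V : Set E} (hG : IsMetricOn G V)
    {G' : F → F →L[ℝ] F →L[ℝ] ℝ} {V' : Set F} (hG' : IsMetricOn G' V') {Ψ : E → F} {y : E}
    (hy : y ∈ V) (hy' : Ψ y ∈ V') (hΨ : ContDiffAt ℝ ∞ Ψ y)
    (hpull : ∀ᶠ z in 𝓝 y, ∀ u v, G z u v = G' (Ψ z) (fderiv ℝ Ψ z u) (fderiv ℝ Ψ z v))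
    (hsurj : Function.Surjective (fderiv ℝ Ψ y)) (u v : E) :
    fderiv ℝ Ψ y (christoffel G y u v)
      = fderiv ℝ (fderiv ℝ Ψ) y u v + christoffel G' (Ψ y) (fderiv ℝ Ψ y u) (fderiv ℝ Ψ y v) := by
  refine hG'.eq_of_forall hy' fun w' ↦ ?_
  obtain ⟨w, rfl⟩ := hsurj w'
  have hΨd := (hΨ.differentiableAt (by simp)).hasFDerivAt
  have hΨ2 := ((hΨ.fderiv_right (m := ∞) (by simp)).differentiableAt (by simp)).hasFDerivAt
  have s2 : ∀ a b, fderiv ℝ (fderiv ℝ Ψ) y a b = fderiv ℝ (fderiv ℝ Ψ) y b a :=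
    (hΨ.isSymmSndFDerivAt minSmoothness_two_le_infty).eq
  have key : ∀ u v w, fderiv ℝ G y u v w
      = fderiv ℝ G' (Ψ y) (fderiv ℝ Ψ y u) (fderiv ℝ Ψ y v) (fderiv ℝ Ψ y w)
        + G' (Ψ y) (fderiv ℝ (fderiv ℝ Ψ) y u v) (fderiv ℝ Ψ y w)
        + G' (Ψ y) (fderiv ℝ Ψ y v) (fderiv ℝ (fderiv ℝ Ψ) y u w) := by
    intro u v w
    have h1 := hG.hasFDerivAt_apply (c := fun z ↦ z) (X := fun _ ↦ v) (Y := fun _ ↦ w) hy rfl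
      (hasFDerivAt_id y) (hasFDerivAt_const _ _) (hasFDerivAt_const _ _) u
    have h2 := hG'.hasFDerivAt_apply hy' rfl hΨd
      (hΨ2.clm_apply (hasFDerivAt_const v y)) (hΨ2.clm_apply (hasFDerivAt_const w y)) u
    have h3 : (fun z ↦ G z v w) =ᶠ[𝓝 y]
        fun z ↦ G' (Ψ z) (fderiv ℝ Ψ z v) (fderiv ℝ Ψ z w) := by
      filter_upwards [hpull] with z hz using hz v w
    rw [h3.fderiv_eq, h2] at h1
    simpa using h1.symm
  have h1 := hpull.self_of_nhds (christoffel G y u v) w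
  rw [hG.apply_christoffel hy] at h1
  rw [← h1, map_add, add_apply, hG'.apply_christoffel hy',
    christoffelLower_apply, christoffelLower_apply, key, key, key, s2 w u, s2 w v, s2 v u,
    hG'.symm _ hy' (fderiv ℝ (fderiv ℝ Ψ) y u w)]
  ring

end LocalGeom

/-! ### Hypersurfaces in coordinates -/

namespace LocalGeom

variable {E F : Type*} [NormedAddCommGroup E] [NormedSpace ℝ E]
  [NormedAddCommGroup F] [NormedSpace ℝ F]

theorem alongDeriv_comp {F' : Type*} [NormedAddCommGroup F'] [NormedSpace ℝ F']
    (G : E → E →L[ℝ] E →L[ℝ] ℝ) {f X : F → E} {c : F' → F} {x : F'}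
    (hf : DifferentiableAt ℝ f (c x)) (hX : DifferentiableAt ℝ X (c x))
    (hc : DifferentiableAt ℝ c x) (v : F') :
    alongDeriv G (fun z ↦ f (c z)) (fun z ↦ X (c z)) x v
      = alongDeriv G f X (c x) (fderiv ℝ c x v) := by
  rw [alongDeriv_apply, alongDeriv_apply]
  have h1 : fderiv ℝ (fun z ↦ f (c z)) x = _ := fderiv_comp x hf hc
  have h2 : fderiv ℝ (fun z ↦ X (c z)) x = _ := fderiv_comp x hX hc
  rw [h1, h2]
  rfl

theorem alongDeriv_congr (G : E → E →L[ℝ] E →L[ℝ] ℝ) {f f' X X' : F → E} {x : F}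
    (hf : f =ᶠ[𝓝 x] f') (hX : X =ᶠ[𝓝 x] X') : alongDeriv G f X x = alongDeriv G f' X' x := by
  rw [alongDeriv, alongDeriv, hf.fderiv_eq, hX.fderiv_eq, hf.eq_of_nhds, hX.eq_of_nhds]

/-- A nondegenerate hypersurface `f : U → V` of the coordinate domain `V` with metric `G`, with a
unit normal field `n` of positive square. -/
structure LocalHypersurface (G : E → E →L[ℝ] E →L[ℝ] ℝ) (V : Set E) (f n : F → E) (U : Set F) :
    Prop where
  metric : IsMetricOn G V
  isOpen : IsOpen U
  mapsTo : ∀ x ∈ U, f x ∈ V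
  contDiffOn : ContDiffOn ℝ ∞ f U
  contDiffOn_normal : ContDiffOn ℝ ∞ n U
  codim : Module.finrank ℝ E = Module.finrank ℝ F + 1
  normal : ∀ x ∈ U, ∀ v, G (f x) (n x) (fderiv ℝ f x v) = 0
  unit : ∀ x ∈ U, G (f x) (n x) (n x) = 1
  nondegenerate : ∀ x ∈ U, ∀ v, (∀ w, G (f x) (fderiv ℝ f x v) (fderiv ℝ f x w) = 0) → v = 0

/-- The map `(v, a) ↦ ∂_v f + a n` identifying `F × ℝ` with the ambient tangent space along a
hypersurface. -/
def frame (f n : F → E) (x : F) : F × ℝ →L[ℝ] E :=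
  (fderiv ℝ f x).coprod (ContinuousLinearMap.toSpanSingleton ℝ (n x))

/-- The tangential projection, with values in the coordinates of the hypersurface. -/
def tangentProj (f n : F → E) (x : F) : E →L[ℝ] F :=
  ContinuousLinearMap.fst ℝ F ℝ ∘L (frame f n x).inverse

namespace LocalHypersurface

variable {G : E → E →L[ℝ] E →L[ℝ] ℝ} {V : Set E} {f n : F → E} {U : Set F}
  (h : LocalHypersurface G V f n U)
include h

theorem contDiffAt {x : F} (hx : x ∈ U) : ContDiffAt ℝ ∞ f x :=
  h.contDiffOn.contDiffAt (h.isOpen.mem_nhds hx)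

theorem contDiffAt_normal {x : F} (hx : x ∈ U) : ContDiffAt ℝ ∞ n x :=
  h.contDiffOn_normal.contDiffAt (h.isOpen.mem_nhds hx)

theorem differentiableAt {x : F} (hx : x ∈ U) : DifferentiableAt ℝ f x :=
  (h.contDiffAt hx).differentiableAt (by simp)

theorem differentiableAt_normal {x : F} (hx : x ∈ U) : DifferentiableAt ℝ n x :=
  (h.contDiffAt_normal hx).differentiableAt (by simp)

theorem contDiffAt_fderiv {x : F} (hx : x ∈ U) : ContDiffAt ℝ ∞ (fderiv ℝ f) x :=
  (h.contDiffAt hx).fderiv_right (by simp)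

theorem differentiableAt_fderiv {x : F} (hx : x ∈ U) : DifferentiableAt ℝ (fderiv ℝ f) x :=
  (h.contDiffAt_fderiv hx).differentiableAt (by simp)

theorem normal' {x : F} (hx : x ∈ U) (v : F) : G (f x) (fderiv ℝ f x v) (n x) = 0 := by
  rw [h.metric.symm _ (h.mapsTo x hx), h.normal x hx]

/-- The derivative of a unit normal is tangential. -/
theorem apply_alongDeriv_normal {x : F} (hx : x ∈ U) (v : F) :
    G (f x) (n x) (alongDeriv G f n x v) = 0 := by
  have h1 := h.metric.fderiv_apply_eq (h.mapsTo x hx) (h.differentiableAt hx)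
    (h.differentiableAt_normal hx) (h.differentiableAt_normal hx) v
  have h2 : (fun z ↦ G (f z) (n z) (n z)) =ᶠ[𝓝 x] fun _ ↦ 1 := by
    filter_upwards [h.isOpen.mem_nhds hx] with z hz using h.unit z hz
  rw [h2.fderiv_eq, h.metric.symm _ (h.mapsTo x hx) _ (n x)] at h1
  simp at h1
  linarith

/-- The second fundamental form is, up to sign, the normal part of the Hessian of `f`. -/
theorem secondFundamentalForm_eq {x : F} (hx : x ∈ U) (v w : F) :
    G (f x) (alongDeriv G f n x v) (fderiv ℝ f x w)
      = -G (f x) (n x) (alongDeriv G f (fun z ↦ fderiv ℝ f z w) x v) := by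
  have h1 := h.metric.fderiv_apply_eq (h.mapsTo x hx) (h.differentiableAt hx)
    (h.differentiableAt_normal hx)
    ((h.differentiableAt_fderiv hx).clm_apply (differentiableAt_const w)) v
  have h2 : (fun z ↦ G (f z) (n z) (fderiv ℝ f z w)) =ᶠ[𝓝 x] fun _ ↦ 0 := by
    filter_upwards [h.isOpen.mem_nhds hx] with z hz using h.normal z hz w
  rw [h2.fderiv_eq] at h1
  simp at h1
  linarith

theorem alongDeriv_fderiv {x : F} (hx : x ∈ U) (v w : F) :
    alongDeriv G f (fun z ↦ fderiv ℝ f z w) x v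
      = fderiv ℝ (fderiv ℝ f) x v w
        + christoffel G (f x) (fderiv ℝ f x v) (fderiv ℝ f x w) := by
  have := ((h.differentiableAt_fderiv hx).hasFDerivAt.clm_apply (hasFDerivAt_const w x)).fderiv
  rw [alongDeriv_apply, this]
  simp

theorem alongDeriv_fderiv_symm {x : F} (hx : x ∈ U) (v w : F) :
    alongDeriv G f (fun z ↦ fderiv ℝ f z w) x v
      = alongDeriv G f (fun z ↦ fderiv ℝ f z v) x w := by
  rw [h.alongDeriv_fderiv hx, h.alongDeriv_fderiv hx,
    ((h.contDiffAt hx).isSymmSndFDerivAt minSmoothness_two_le_infty).eq,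
    h.metric.christoffel_symm (h.mapsTo x hx)]

/-- The second fundamental form is written out as `G(∇_v n, ∂_w f)`, as it is throughout. -/
theorem secondFundamentalForm_symm {x : F} (hx : x ∈ U) (v w : F) :
    G (f x) (alongDeriv G f n x v) (fderiv ℝ f x w)
      = G (f x) (alongDeriv G f n x w) (fderiv ℝ f x v) := by
  rw [h.secondFundamentalForm_eq hx, h.secondFundamentalForm_eq hx, h.alongDeriv_fderiv_symm hx]

/-- The second fundamental form vanishes in the direction of a geodesic of the ambient space lying
in the hypersurface. -/
theorem secondFundamentalForm_eq_zero_of_geodesic {c : ℝ → F} {t : ℝ} (hct : c t ∈ U)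
    (hc : ContDiffAt ℝ ∞ c t)
    (hgeo : alongDeriv G (fun r ↦ f (c r)) (deriv fun r ↦ f (c r)) t 1 = 0) :
    G (f (c t)) (alongDeriv G f n (c t) (deriv c t)) (fderiv ℝ f (c t) (deriv c t)) = 0 := by
  have hcU : ∀ᶠ r in 𝓝 t, c r ∈ U := hc.continuousAt.eventually_mem (h.isOpen.mem_nhds hct)
  have hcd : ∀ᶠ r in 𝓝 t, DifferentiableAt ℝ c r := by
    filter_upwards [(hc.of_le (m := 1) (by simp)).eventually (by simp)] with r hr
      using hr.differentiableAt (by simp)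
  have hderiv : ∀ r, c r ∈ U → DifferentiableAt ℝ c r →
      deriv (fun r ↦ f (c r)) r = fderiv ℝ f (c r) (deriv c r) := fun r h1 h2 ↦
    ((h.differentiableAt h1).hasFDerivAt.comp_hasDerivAt r h2.hasDerivAt).deriv
  have hf : ContDiffAt ℝ ∞ (fun r ↦ f (c r)) t := (h.contDiffAt hct).comp t hc
  have hf' : DifferentiableAt ℝ (deriv fun r ↦ f (c r)) t := by
    have : ContDiffAt ℝ ∞ (fun r ↦ fderiv ℝ (fun r ↦ f (c r)) r 1) t :=
      (hf.fderiv_right (by simp)).clm_apply contDiffAt_const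
    exact this.differentiableAt (by simp)
  have hn : DifferentiableAt ℝ (fun r ↦ n (c r)) t :=
    (h.differentiableAt_normal hct).comp t (hc.differentiableAt (by simp))
  have h1 := h.metric.fderiv_apply_eq (c := fun r ↦ f (c r)) (h.mapsTo _ hct)
    (hf.differentiableAt (by simp)) hn hf' (1 : ℝ)
  have h2 : (fun r ↦ G (f (c r)) (n (c r)) (deriv (fun r ↦ f (c r)) r)) =ᶠ[𝓝 t] fun _ ↦ 0 := by
    filter_upwards [hcU, hcd] with r h3 h4
    rw [hderiv r h3 h4, h.normal _ h3]
  rw [h2.fderiv_eq, hgeo, alongDeriv_comp G (h.differentiableAt hct)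
    (h.differentiableAt_normal hct) (hc.differentiableAt (by simp)),
    hderiv t hct (hc.differentiableAt (by simp))] at h1
  simpa using h1.symm

variable [FiniteDimensional ℝ E]

theorem contDiffAt_alongDeriv_normal {x : F} (hx : x ∈ U) :
    ContDiffAt ℝ ∞ (alongDeriv G f n) x :=
  h.metric.contDiffAt_alongDeriv (h.mapsTo x hx) (h.contDiffAt hx) (h.contDiffAt_normal hx)

variable [FiniteDimensional ℝ F]

/-- A dimension count, as the unit normal is transversal to the hypersurface. -/
theorem frame_isInvertible {x : F} (hx : x ∈ U) : (frame f n x).IsInvertible := by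
  have hinj : Function.Injective (frame f n x : F × ℝ →ₗ[ℝ] E) := by
    rw [injective_iff_map_eq_zero]
    rintro ⟨v, a⟩ hva
    have hva : fderiv ℝ f x v + a • n x = 0 := by simpa [frame] using hva
    have ha : a = 0 := by
      have := congrArg (G (f x) (n x)) hva
      simpa [h.normal x hx, h.unit x hx] using this
    subst ha
    simp only [zero_smul, add_zero] at hva
    rw [h.nondegenerate x hx v fun w ↦ by simp [hva]]
    rfl
  exact ⟨(LinearEquiv.ofInjectiveOfFinrankEq (frame f n x : F × ℝ →ₗ[ℝ] E) hinj
    (by simp [h.codim])).toContinuousLinearEquiv, by ext <;> rfl⟩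

/-- The orthogonal decomposition into tangential and normal part. -/
theorem decomp {x : F} (hx : x ∈ U) (e : E) :
    fderiv ℝ f x (tangentProj f n x e) + G (f x) (n x) e • n x = e := by
  have h1 : fderiv ℝ f x (tangentProj f n x e) + ((frame f n x).inverse e).2 • n x = e := by
    have := (h.frame_isInvertible hx).self_apply_inverse e
    simpa [frame, tangentProj] using this
  have h2 : ((frame f n x).inverse e).2 = G (f x) (n x) e := by
    conv_rhs => rw [← h1]
    simp [h.normal x hx, h.unit x hx]
  rwa [h2] at h1

theorem tangentProj_fderiv {x : F} (hx : x ∈ U) (v : F) :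
    tangentProj f n x (fderiv ℝ f x v) = v := by
  have h1 : frame f n x (v, 0) = fderiv ℝ f x v := by simp [frame]
  rw [← h1, tangentProj, ContinuousLinearMap.comp_apply,
    (h.frame_isInvertible hx).inverse_apply_self]
  rfl

theorem contDiffAt_tangentProj {x : F} (hx : x ∈ U) : ContDiffAt ℝ ∞ (tangentProj f n) x := by
  have h1 : ContDiffAt ℝ ∞ (frame f n) x := by
    have h2 : ContDiffAt ℝ ∞ (fun z ↦ ContinuousLinearMap.toSpanSingleton ℝ (n z)) x :=
      (ContinuousLinearMap.toSpanSingletonCLE (𝕜 := ℝ) (E := E)).contDiff.contDiffAt.comp x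
        (h.contDiffAt_normal hx)
    have h3 : ContDiffAt ℝ ∞ (fun z ↦ fderiv ℝ f z ∘L ContinuousLinearMap.fst ℝ F ℝ
        + ContinuousLinearMap.toSpanSingleton ℝ (n z) ∘L ContinuousLinearMap.snd ℝ F ℝ) x :=
      ((h.contDiffAt_fderiv hx).clm_comp contDiffAt_const).add (h2.clm_comp contDiffAt_const)
    refine h3.congr_of_eventuallyEq (.of_forall fun z ↦ ?_)
    ext <;> simp [frame]
  exact contDiffAt_const.clm_comp
    (ContDiffAt.comp x (h.frame_isInvertible hx).contDiffAt_map_inverse h1)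

end LocalHypersurface

end LocalGeom

/-! ### Umbilic hypersurfaces in coordinates -/

namespace LocalGeom

variable {E F : Type*} [NormedAddCommGroup E] [NormedSpace ℝ E] [FiniteDimensional ℝ E]
  [NormedAddCommGroup F] [NormedSpace ℝ F] [FiniteDimensional ℝ F]

/-- The geodesic spray of a hypersurface with respect to its induced metric, expressed through the
connection of the ambient space: `(x, v) ↦ (v, -P(D²f(v, v) + Γ(∂_v f, ∂_v f)))`, with `P` the
tangential projection. -/
def hypersurfaceSpray (G : E → E →L[ℝ] E →L[ℝ] ℝ) (f n : F → E) (p : F × F) : F × F :=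
  (p.2, -tangentProj f n p.1 (fderiv ℝ (fderiv ℝ f) p.1 p.2 p.2
    + christoffel G (f p.1) (fderiv ℝ f p.1 p.2) (fderiv ℝ f p.1 p.2)))

namespace LocalHypersurface

variable {G : E → E →L[ℝ] E →L[ℝ] ℝ} {V : Set E} {f n : F → E} {U : Set F}
  (h : LocalHypersurface G V f n U)
include h

theorem contDiffAt_hypersurfaceSpray {p : F × F} (hp : p.1 ∈ U) :
    ContDiffAt ℝ ∞ (hypersurfaceSpray G f n) p := by
  have hf : ContDiffAt ℝ ∞ (fun q : F × F ↦ fderiv ℝ f q.1 q.2) p :=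
    ((h.contDiffAt_fderiv hp).comp p contDiffAt_fst).clm_apply contDiffAt_snd
  have hf2 : ContDiffAt ℝ ∞ (fun q : F × F ↦ fderiv ℝ (fderiv ℝ f) q.1 q.2 q.2) p :=
    ((((h.contDiffAt_fderiv hp).fderiv_right (m := ∞) (by simp)).comp p contDiffAt_fst).clm_apply
      contDiffAt_snd).clm_apply contDiffAt_snd
  have hΓ : ContDiffAt ℝ ∞ (fun q : F × F ↦ christoffel G (f q.1)) p :=
    ((h.metric.contDiffAt_christoffel (h.mapsTo _ hp)).comp p.1 (h.contDiffAt hp)).comp p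
      contDiffAt_fst
  exact contDiffAt_snd.prodMk ((((h.contDiffAt_tangentProj hp).comp p contDiffAt_fst).clm_apply
    (hf2.add ((hΓ.clm_apply hf).clm_apply hf))).neg)

/-- A hypersurface has a smooth local retraction onto its parameter domain. -/
theorem exists_leftInverse {x : F} (hx : x ∈ U) :
    ∃ ρ : E → F, ContDiffAt ℝ ∞ ρ (f x) ∧ ∀ᶠ y in 𝓝 x, ρ (f y) = y := by
  -- invert the map `(y, a) ↦ f y + a n(x)`, whose derivative at `(x, 0)` is the frame
  obtain ⟨e, he⟩ := h.frame_isInvertible hx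
  let Φ : F × ℝ → E := fun q ↦ f q.1 + q.2 • n x
  have hΦ : ContDiffAt ℝ ∞ Φ (x, 0) :=
    ((h.contDiffAt hx).comp (x, (0 : ℝ)) contDiffAt_fst).add (contDiffAt_snd.smul contDiffAt_const)
  have hΦ' : HasFDerivAt Φ (e : F × ℝ →L[ℝ] E) (x, 0) := by
    have h1 : HasFDerivAt (fun q : F × ℝ ↦ f q.1) (fderiv ℝ f x ∘L ContinuousLinearMap.fst ℝ F ℝ)
        (x, 0) := (h.differentiableAt hx).hasFDerivAt.comp (x, (0 : ℝ)) hasFDerivAt_fst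
    have h2 : HasFDerivAt (fun q : F × ℝ ↦ q.2 • n x)
        ((ContinuousLinearMap.snd ℝ F ℝ).smulRight (n x)) (x, 0) :=
      hasFDerivAt_snd.smul_const (n x)
    refine (h1.add h2).congr_fderiv ?_
    rw [he]
    ext <;> simp [frame]
  have hinf : (∞ : WithTop ℕ∞) ≠ 0 := by simp
  have hstrict := hΦ.hasStrictFDerivAt' hΦ' hinf
  refine ⟨fun z ↦ (hΦ.localInverse hΦ' hinf z).1, ?_, ?_⟩
  · have h1 := hΦ.to_localInverse hΦ' hinf
    have h2 : Φ (x, 0) = f x := by simp [Φ]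
    rw [h2] at h1
    exact contDiffAt_fst.comp _ h1
  · have h1 : ∀ᶠ q in 𝓝 (x, (0 : ℝ)), hΦ.localInverse hΦ' hinf (Φ q) = q :=
      hstrict.eventually_left_inverse
    have h2 : Filter.Tendsto (fun y : F ↦ (y, (0 : ℝ))) (𝓝 x) (𝓝 (x, 0)) :=
      (Continuous.prodMk_left (0 : ℝ)).continuousAt
    filter_upwards [h2.eventually h1] with y hy
    have h3 : Φ (y, 0) = f y := by simp [Φ]
    rw [h3] at hy
    rw [hy]

variable {lam : F → ℝ} (hlam : ∀ x ∈ U, ∀ v w,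
  G (f x) (alongDeriv G f n x v) (fderiv ℝ f x w)
    = lam x * G (f x) (fderiv ℝ f x v) (fderiv ℝ f x w))
include hlam

/-- The Weingarten map of an umbilic hypersurface is a multiple of the identity: `∇n` has no normal
part, and `lam ∂f` has the same inner products with tangent vectors. -/
theorem alongDeriv_normal_of_umbilic {x : F} (hx : x ∈ U) (v : F) :
    alongDeriv G f n x v = lam x • fderiv ℝ f x v := by
  refine h.metric.eq_of_forall (h.mapsTo x hx) fun w ↦ ?_
  rw [← h.decomp hx w]
  simp only [map_add, map_smul, smul_apply, smul_eq_mul, hlam x hx, h.normal' hx,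
    h.metric.symm _ (h.mapsTo x hx) _ (n x), h.apply_alongDeriv_normal hx]
  simp

omit [FiniteDimensional ℝ F] in
/-- The factor `lam` is a quotient of smooth functions, since `v` stays non-null near `x`. -/
theorem contDiffAt_of_umbilic {x : F} (hx : x ∈ U) {v : F}
    (hv : G (f x) (fderiv ℝ f x v) (fderiv ℝ f x v) ≠ 0) : ContDiffAt ℝ ∞ lam x := by
  have hG : ContDiffAt ℝ ∞ (fun z ↦ G (f z)) x :=
    (h.metric.contDiffAt (h.mapsTo x hx)).comp x (h.contDiffAt hx)
  have hfv : ContDiffAt ℝ ∞ (fun z ↦ fderiv ℝ f z v) x :=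
    (h.contDiffAt_fderiv hx).clm_apply contDiffAt_const
  have hW : ContDiffAt ℝ ∞ (fun z ↦ alongDeriv G f n z v) x :=
    (h.contDiffAt_alongDeriv_normal hx).clm_apply contDiffAt_const
  have hden : ContDiffAt ℝ ∞ (fun z ↦ G (f z) (fderiv ℝ f z v) (fderiv ℝ f z v)) x :=
    (hG.clm_apply hfv).clm_apply hfv
  refine (((hG.clm_apply hW).clm_apply hfv).div hden hv).congr_of_eventuallyEq ?_
  filter_upwards [h.isOpen.mem_nhds hx, hden.continuousAt.eventually_ne hv] with z hz hz'
  rw [Pi.div_apply, hlam z hz]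
  exact (mul_div_cancel_right₀ _ hz').symm

/-- The contracted Codazzi equation of an umbilic hypersurface: differentiating `∇n = lam ∂f` once
more gives `R(∂_u f, ∂_v f) n = (∂_u lam) ∂_v f - (∂_v lam) ∂_u f`, and the trace over `u` is taken
in the frame adapted to the hypersurface. -/
theorem ricci_normal_of_umbilic {x : F} (hx : x ∈ U) (hl : DifferentiableAt ℝ lam x) (v : F) :
    ricci G (f x) (fderiv ℝ f x v) (n x)
      = (1 - (Module.finrank ℝ F : ℝ)) * fderiv ℝ lam x v := by
  set A := curvature G (f x) (fderiv ℝ f x v) (n x) with hA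
  have key : ∀ u v, alongDeriv G f (fun z ↦ alongDeriv G f n z v) x u
      = fderiv ℝ lam x u • fderiv ℝ f x v
        + lam x • alongDeriv G f (fun z ↦ fderiv ℝ f z v) x u := by
    intro u v
    have hev : (fun z ↦ alongDeriv G f n z v) =ᶠ[𝓝 x] fun z ↦ lam z • fderiv ℝ f z v := by
      filter_upwards [h.isOpen.mem_nhds hx] with z hz
        using h.alongDeriv_normal_of_umbilic hlam hz v
    have hd := (h.differentiableAt_fderiv hx).clm_apply (differentiableAt_const v)
    have hs : fderiv ℝ (fun z ↦ lam z • fderiv ℝ f z v) x = _ :=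
      (hl.hasFDerivAt.smul hd.hasFDerivAt).fderiv
    rw [alongDeriv_congr G (.refl _ _) hev, alongDeriv_apply, hs, alongDeriv_apply]
    simp
    abel
  have hcurv : ∀ u, A (fderiv ℝ f x u)
      = fderiv ℝ lam x u • fderiv ℝ f x v - fderiv ℝ lam x v • fderiv ℝ f x u := by
    intro u
    rw [hA, ← h.metric.alongDeriv_alongDeriv_sub (h.mapsTo x hx) (h.contDiffAt hx)
      (h.contDiffAt_normal hx), key, key, h.alongDeriv_fderiv_symm hx u v]
    abel
  have hAn : G (f x) (n x) (A (n x)) = 0 := by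
    rw [h.metric.symm _ (h.mapsTo x hx)]
    exact h.metric.curvature_skew (h.mapsTo x hx) _ _ _
  -- split the trace into its tangential and normal parts
  let D : F →ₗ[ℝ] E := fderiv ℝ f x
  let P : E →ₗ[ℝ] F := tangentProj f n x
  let ν : E →ₗ[ℝ] ℝ := G (f x) (n x)
  have hsplit : (A : E →ₗ[ℝ] E) = ((A : E →ₗ[ℝ] E) ∘ₗ D) ∘ₗ P + ν.smulRight (A (n x)) := by
    ext e
    have := congrArg A (h.decomp hx e)
    rw [map_add, map_smul] at this
    exact this.symm
  have htan : P ∘ₗ (A : E →ₗ[ℝ] E) ∘ₗ D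
      = (fderiv ℝ lam x : F →ₗ[ℝ] ℝ).smulRight v - fderiv ℝ lam x v • LinearMap.id := by
    ext u
    change tangentProj f n x (A (fderiv ℝ f x u)) = _
    rw [hcurv, map_sub, map_smul, map_smul, h.tangentProj_fderiv hx, h.tangentProj_fderiv hx]
    rfl
  rw [ricci_apply, ← hA, hsplit, map_add, LinearMap.trace_smulRight, LinearMap.trace_comp_comm',
    htan, map_sub, map_smul, LinearMap.trace_smulRight, LinearMap.trace_id]
  change fderiv ℝ lam x v - fderiv ℝ lam x v • _ + G (f x) (n x) (A (n x)) = _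
  rw [hAn, smul_eq_mul]
  ring

/-- A curve in the hypersurface whose lift is an integral curve of the spray has acceleration
`-χ(c', c') n`; if the hypersurface is umbilic and the initial velocity is null, then the
acceleration vanishes. -/
theorem null_geodesic_of_spray {ε : ℝ} {α : ℝ → F × F}
    (hU : ∀ t ∈ Set.Ioo (-ε) ε, (α t).1 ∈ U)
    (hα : ∀ t ∈ Set.Ioo (-ε) ε, HasDerivAt α (hypersurfaceSpray G f n (α t)) t)
    (h0 : (0 : ℝ) ∈ Set.Ioo (-ε) ε)
    (hk : G (f (α 0).1) (fderiv ℝ f (α 0).1 (α 0).2) (fderiv ℝ f (α 0).1 (α 0).2) = 0)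
    {t : ℝ} (ht : t ∈ Set.Ioo (-ε) ε) :
    alongDeriv G (fun r ↦ f (α r).1) (deriv fun r ↦ f (α r).1) t 1 = 0 ∧
      G (f (α t).1) (fderiv ℝ f (α t).1 (α t).2) (fderiv ℝ f (α t).1 (α t).2) = 0 := by
  set c : ℝ → F := fun t ↦ (α t).1
  set X : ℝ → E := fun t ↦ fderiv ℝ f (c t) (α t).2
  have hc : ∀ t ∈ Set.Ioo (-ε) ε, HasDerivAt c (α t).2 t := fun t ht ↦
    (ContinuousLinearMap.fst ℝ F F).hasFDerivAt.comp_hasDerivAt t (hα t ht)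
  have hγ : ∀ t ∈ Set.Ioo (-ε) ε, HasDerivAt (fun r ↦ f (c r)) (X t) t := fun t ht ↦
    (h.differentiableAt (hU t ht)).hasFDerivAt.comp_hasDerivAt t (hc t ht)
  have hev : ∀ t ∈ Set.Ioo (-ε) ε, (deriv fun r ↦ f (c r)) =ᶠ[𝓝 t] X := fun t ht ↦ by
    filter_upwards [isOpen_Ioo.mem_nhds ht] with r hr using (hγ r hr).deriv
  have hX : ∀ t ∈ Set.Ioo (-ε) ε,
      HasDerivAt X (fderiv ℝ (fderiv ℝ f) (c t) (α t).2 (α t).2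
          + fderiv ℝ f (c t) (hypersurfaceSpray G f n (α t)).2) t := by
    intro t ht
    have h1 := (h.differentiableAt_fderiv (hU t ht)).hasFDerivAt.comp_hasDerivAt t (hc t ht)
    have h2 := (ContinuousLinearMap.snd ℝ F F).hasFDerivAt.comp_hasDerivAt t (hα t ht)
    exact h1.clm_apply h2
  have hacc : ∀ t ∈ Set.Ioo (-ε) ε, alongDeriv G (fun r ↦ f (c r)) X t 1
      = -(lam (c t) * G (f (c t)) (X t) (X t)) • n (c t) := by
    intro t ht
    have htU : c t ∈ U := hU t ht
    have hd := h.decomp htU (alongDeriv G f (fun z ↦ fderiv ℝ f z (α t).2) (c t) (α t).2)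
    rw [← eq_sub_iff_add_eq'] at hd
    rw [alongDeriv_apply, (hX t ht).hasFDerivAt.fderiv, (hγ t ht).hasFDerivAt.fderiv,
      ← hlam _ htU, h.secondFundamentalForm_eq htU, neg_neg, hd, h.alongDeriv_fderiv htU]
    simp only [ContinuousLinearMap.toSpanSingleton_apply, one_smul, hypersurfaceSpray, map_neg]
    abel
  have hnull : ∀ t ∈ Set.Ioo (-ε) ε, G (f (c t)) (X t) (X t) = 0 := by
    have hderiv : Set.EqOn (fderiv ℝ (fun r ↦ G (f (c r)) (X r) (X r))) 0 (Set.Ioo (-ε) ε) := by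
      intro t ht
      have htU : c t ∈ U := hU t ht
      ext
      rw [h.metric.fderiv_apply_eq (c := fun r ↦ f (c r)) (h.mapsTo _ htU)
        (hγ t ht).differentiableAt (hX t ht).differentiableAt (hX t ht).differentiableAt, hacc t ht]
      simp [X, h.normal' htU, h.normal _ htU]
    have hdiff : DifferentiableOn ℝ (fun r ↦ G (f (c r)) (X r) (X r)) (Set.Ioo (-ε) ε) := by
      intro t ht
      have h1 : DifferentiableAt ℝ (fun r ↦ G (f (c r))) t :=
        (h.metric.differentiableAt (h.mapsTo _ (hU t ht))).comp t (hγ t ht).differentiableAt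
      exact ((h1.clm_apply (hX t ht).differentiableAt).clm_apply
        (hX t ht).differentiableAt).differentiableWithinAt
    intro t ht
    rw [isOpen_Ioo.is_const_of_fderiv_eq_zero isPreconnected_Ioo hdiff hderiv ht h0]
    exact hk
  refine ⟨?_, hnull t ht⟩
  rw [alongDeriv_congr G (.refl _ _) (hev t ht), hacc t ht, hnull t ht]
  simp

omit hlam in
/-- Picard-Lindelöf for the geodesic spray; smoothness of the solution comes from that of the
spray. -/
theorem exists_spray_integralCurve {p : F × F} (hp : p.1 ∈ U) :
    ∃ ε > 0, ∃ α : ℝ → F × F, α 0 = p ∧ ContDiffOn ℝ ∞ α (Set.Ioo (-ε) ε) ∧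
      ∀ t ∈ Set.Ioo (-ε) ε, (α t).1 ∈ U ∧ HasDerivAt α (hypersurfaceSpray G f n (α t)) t := by
  obtain ⟨α, hα0, ε₀, hε₀, hα⟩ :=
    ((h.contDiffAt_hypersurfaceSpray hp).of_le
      (m := 1) (by simp)).exists_forall_mem_closedBall_exists_eq_forall_mem_Ioo_hasDerivAt₀ 0
  rw [zero_sub, zero_add] at hα
  have hcont : ContinuousAt α 0 := (hα 0 ⟨by linarith, hε₀⟩).continuousAt
  have hmem : ∀ᶠ t in 𝓝 (0 : ℝ), (α t).1 ∈ U := by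
    refine (continuous_fst.continuousAt.comp hcont).eventually_mem ?_
    rw [Function.comp_apply, hα0]
    exact h.isOpen.mem_nhds hp
  obtain ⟨δ, hδ, hball⟩ := Metric.eventually_nhds_iff.1 hmem
  obtain ⟨ε, hε, hεδ⟩ : ∃ ε > 0, ε < min δ ε₀ := exists_between (lt_min hδ hε₀)
  have hU : ∀ t ∈ Set.Icc (-ε) ε, (α t).1 ∈ U := fun t ht ↦ hball <| by
    rw [Real.dist_0_eq_abs]
    exact (abs_le.2 ht).trans_lt (hεδ.trans_le (min_le_left _ _))
  have hα' : ∀ t ∈ Set.Icc (-ε) ε, HasDerivAt α (hypersurfaceSpray G f n (α t)) t := fun t ht ↦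
    hα t (by
      have := hεδ.trans_le (min_le_right _ _)
      exact ⟨by linarith [ht.1], by linarith [ht.2]⟩)
  have hspray : ContDiffOn ℝ ∞ (hypersurfaceSpray G f n) (U ×ˢ Set.univ) := fun q hq ↦
    (h.contDiffAt_hypersurfaceSpray hq.1).contDiffWithinAt
  have hsmooth : ContDiffOn ℝ ∞ α (Set.Icc (-ε) ε) :=
    ODE.contDiffOn_enat_Icc_of_hasDerivWithinAt (n := ⊤)
      (f := fun _ ↦ hypersurfaceSpray G f n) (u := U ×ˢ Set.univ)
      (hspray.comp contDiff_snd.contDiffOn fun q hq ↦ hq.2)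
      (fun t ht ↦ (hα' t ht).hasDerivWithinAt) fun t ht ↦ ⟨hU t ht, trivial⟩
  have hsub : Set.Ioo (-ε) ε ⊆ Set.Icc (-ε) ε := Set.Ioo_subset_Icc_self
  exact ⟨ε, hε, α, hα0, hsmooth.mono hsub, fun t ht ↦ ⟨hU t (hsub ht), hα' t (hsub ht)⟩⟩

/-- Along an umbilic hypersurface, the geodesics of the induced metric with null initial velocity
are null geodesics of the ambient space. -/
theorem exists_null_geodesic_of_umbilic {x₀ k : F} (hx₀ : x₀ ∈ U)
    (hk : G (f x₀) (fderiv ℝ f x₀ k) (fderiv ℝ f x₀ k) = 0) :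
    ∃ ε > 0, ∃ c : ℝ → F, ContDiffOn ℝ ∞ c (Set.Ioo (-ε) ε) ∧ c 0 = x₀ ∧ deriv c 0 = k ∧
      ∀ t ∈ Set.Ioo (-ε) ε, c t ∈ U ∧
        alongDeriv G (fun r ↦ f (c r)) (deriv fun r ↦ f (c r)) t 1 = 0 ∧
        G (f (c t)) (fderiv ℝ f (c t) (deriv c t)) (fderiv ℝ f (c t) (deriv c t)) = 0 := by
  obtain ⟨ε, hε, α, hα0, hsmooth, hα⟩ := h.exists_spray_integralCurve (p := (x₀, k)) hx₀
  have h0 : (0 : ℝ) ∈ Set.Ioo (-ε) ε := ⟨by linarith, hε⟩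
  have hc : ∀ t ∈ Set.Ioo (-ε) ε, deriv (fun t ↦ (α t).1) t = (α t).2 := fun t ht ↦
    ((ContinuousLinearMap.fst ℝ F F).hasFDerivAt.comp_hasDerivAt t (hα t ht).2).deriv
  refine ⟨ε, hε, fun t ↦ (α t).1, contDiff_fst.comp_contDiffOn hsmooth, by simp [hα0],
    by rw [hc 0 h0, hα0], fun t ht ↦ ?_⟩
  have := h.null_geodesic_of_spray hlam (fun t ht ↦ (hα t ht).1) (fun t ht ↦ (hα t ht).2) h0
    (by simpa [hα0] using hk) ht
  rw [hc t ht]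
  exact ⟨(hα t ht).1, this⟩

end LocalHypersurface

end LocalGeom

/-! ### Lorentzian forms and metric traces -/

namespace BilinForm

section

variable {V : Type*} [AddCommGroup V] [Module ℝ V] [TopologicalSpace V]

theorem IsLorentzian.eq_zero {B : V →L[ℝ] V →L[ℝ] ℝ} (hB : IsLorentzian B) {v : V}
    (hv : ∀ w, B v w = 0) : v = 0 := by
  obtain ⟨hsymm, t, ht, hpos⟩ := hB
  by_contra hne
  have := hpos v (by rw [hsymm, hv]) hne
  rw [hv] at this
  exact lt_irrefl _ this

/-- A symmetric form that vanishes on the light cone of a Lorentzian form is a multiple of it. -/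
theorem IsLorentzian.exists_eq_smul {H B : V →L[ℝ] V →L[ℝ] ℝ} (hH : IsLorentzian H)
    (hB : ∀ v w, B v w = B w v) (hnull : ∀ k, k ≠ 0 → H k k = 0 → B k k = 0) :
    ∃ c : ℝ, B = c • H := by
  obtain ⟨hsymm, t, ht, hpos⟩ := hH
  refine ⟨B t t / H t t, ?_⟩
  -- for `e` orthogonal to `t` of the same absolute square, `e ± t` are null
  have hunit : ∀ e, H t e = 0 → H e e = -H t t → B t e = 0 ∧ B e e = -B t t := by
    intro e hte hee
    have hnull' : ∀ s : ℝ, s * s = 1 → B e e + 2 * s * B t e + B t t = 0 := by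
      intro s hs
      have hne : e + s • t ≠ 0 := by
        intro h0
        have := congrArg (H t) h0
        simp only [map_add, map_smul, hte, smul_eq_mul, map_zero, zero_add] at this
        rcases mul_eq_zero.1 this with h | h
        · simp [h] at hs
        · exact ht.ne h
      have h1 := hnull _ hne (by
        simp only [map_add, map_smul, smul_eq_mul, add_apply, smul_apply, hsymm e t, hte, hee]
        linear_combination (H t t) * hs)
      simp only [map_add, map_smul, smul_eq_mul, add_apply, smul_apply, hB e t] at h1
      linear_combination h1 - (B t t) * hs
    have h1 := hnull' 1 (by norm_num)
    have h2 := hnull' (-1) (by norm_num)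
    constructor <;> linarith
  have horth : ∀ e, H t e = 0 → B t e = 0 ∧ B e e = B t t / H t t * H e e := by
    intro e hte
    by_cases he : e = 0
    · simp [he]
    have hee := hpos e hte he
    set r := Real.sqrt (-H t t / H e e) with hr
    have hr2 : r * r = -H t t / H e e := Real.mul_self_sqrt (div_nonneg (by linarith) hee.le)
    have hr0 : r ≠ 0 := by
      intro h0
      rw [h0, zero_mul] at hr2
      exact (div_pos (neg_pos.2 ht) hee).ne hr2
    obtain ⟨h1, h2⟩ := hunit (r • e) (by simp [hte]) (by
      simp only [map_smul, smul_eq_mul, smul_apply]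
      rw [← mul_assoc, hr2]
      field_simp)
    simp only [map_smul, smul_eq_mul, smul_apply] at h1 h2
    refine ⟨(mul_eq_zero.1 h1).resolve_left hr0, ?_⟩
    rw [← mul_assoc, hr2] at h2
    have := ht.ne
    field_simp at h2 ⊢
    linarith
  have hdiag : ∀ v, B v v = B t t / H t t * H v v := by
    intro v
    obtain ⟨a, e, hte, rfl⟩ : ∃ (a : ℝ) (e : V), H t e = 0 ∧ v = a • t + e :=
      ⟨H t v / H t t, v - (H t v / H t t) • t, by simp [ht.ne], by abel⟩
    obtain ⟨h1, h2⟩ := horth e hte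
    simp only [map_add, map_smul, smul_eq_mul, add_apply, smul_apply, hB e t, hsymm e t, h1, h2,
      hte]
    have := ht.ne
    field_simp
    ring
  ext v w
  have h1 := hdiag (v + w)
  simp only [map_add, add_apply, hdiag v, hdiag w, hB w v, hsymm w v] at h1
  simp only [smul_apply, smul_eq_mul]
  linarith

end

theorem metricTrace_neg {V : Type*} [AddCommGroup V] [Module ℝ V] [TopologicalSpace V]
    [IsTopologicalAddGroup V] [ContinuousSMul ℝ V] (G B : V →L[ℝ] V →L[ℝ] ℝ) :
    metricTrace G (-B) = -metricTrace G B := by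
  have : ((G.inverse ∘L (-B) : V →L[ℝ] V) : V →ₗ[ℝ] V)
      = -((G.inverse ∘L B : V →L[ℝ] V) : V →ₗ[ℝ] V) := by
    ext v
    simp
  rw [metricTrace, this, map_neg, metricTrace]

variable {V : Type*} [NormedAddCommGroup V] [NormedSpace ℝ V] [FiniteDimensional ℝ V]

theorem isInvertible_of_nondegenerate {B : V →L[ℝ] V →L[ℝ] ℝ}
    (hB : ∀ v, (∀ w, B v w = 0) → v = 0) : B.IsInvertible := by
  have hinj : Function.Injective (B : V →ₗ[ℝ] V →L[ℝ] ℝ) := by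
    rw [injective_iff_map_eq_zero]
    intro v hv
    exact hB v fun w ↦ by
      have := congrArg (fun φ : V →L[ℝ] ℝ ↦ φ w) hv
      simpa using this
  have hrank : Module.finrank ℝ V = Module.finrank ℝ (V →L[ℝ] ℝ) := by
    rw [← (LinearMap.toContinuousLinearMap : (V →ₗ[ℝ] ℝ) ≃ₗ[ℝ] V →L[ℝ] ℝ).finrank_eq]
    exact Subspace.dual_finrank_eq.symm
  exact ⟨(LinearEquiv.ofInjectiveOfFinrankEq _ hinj hrank).toContinuousLinearEquiv, by ext; rfl⟩

theorem IsLorentzian.isInvertible {B : V →L[ℝ] V →L[ℝ] ℝ} (hB : IsLorentzian B) :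
    B.IsInvertible :=
  isInvertible_of_nondegenerate fun _ ↦ hB.eq_zero

theorem metricTrace_smul_self {G : V →L[ℝ] V →L[ℝ] ℝ} (hG : G.IsInvertible) (c : ℝ) :
    metricTrace G (c • G) = c * Module.finrank ℝ V := by
  have : ((G.inverse ∘L (c • G) : V →L[ℝ] V) : V →ₗ[ℝ] V) = c • LinearMap.id := by
    ext v
    simp [hG.inverse_apply_self]
  rw [metricTrace, this, map_smul, LinearMap.trace_id, smul_eq_mul]

end BilinForm

namespace LocalGeom

variable {F : Type*} [NormedAddCommGroup F] [NormedSpace ℝ F] [FiniteDimensional ℝ F]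

/-- The divergence of `ρ H` is the differential of `ρ`, because `H` is parallel. -/
theorem divergence_smul {H : F → F →L[ℝ] F →L[ℝ] ℝ} {U : Set F} (hH : IsMetricOn H U) {x : F}
    (hx : x ∈ U) {ρ : F → ℝ} (hρ : DifferentiableAt ℝ ρ x) {T : F → F →L[ℝ] F →L[ℝ] ℝ}
    (hT : T =ᶠ[𝓝 x] fun y ↦ ρ y • H y) (a : F) : divergence H T x a = fderiv ℝ ρ x a := by
  have h1 : covDerivForm H T x a = (fderiv ℝ ρ x).smulRight (H x a) := by
    ext u w
    have h2 : fderiv ℝ T x = _ :=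
      hT.fderiv_eq.trans (hρ.hasFDerivAt.smul (hH.differentiableAt hx).hasFDerivAt).fderiv
    rw [covDerivForm_apply, h2, hT.eq_of_nhds]
    simp only [add_apply, smul_apply, ContinuousLinearMap.smulRight_apply, hH.fderiv_eq hx,
      smul_eq_mul]
    ring
  have h2 : (((H x).inverse ∘L (fderiv ℝ ρ x).smulRight (H x a) : F →L[ℝ] F) : F →ₗ[ℝ] F)
      = (fderiv ℝ ρ x : F →ₗ[ℝ] ℝ).smulRight a := by
    ext v
    simp [(hH.nondegenerate x hx).inverse_apply_self]
  rw [divergence, BilinForm.metricTrace, h1, h2, LinearMap.trace_smulRight]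
  rfl

/-- The covariant derivative along a map is natural under local isometries. -/
theorem alongDeriv_naturality {E E' : Type*} [NormedAddCommGroup E] [NormedSpace ℝ E]
    [NormedAddCommGroup E'] [NormedSpace ℝ E'] {F : Type*} [NormedAddCommGroup F]
    [NormedSpace ℝ F]
    {G : E → E →L[ℝ] E →L[ℝ] ℝ} {V : Set E} (hG : IsMetricOn G V)
    {G' : E' → E' →L[ℝ] E' →L[ℝ] ℝ} {V' : Set E'} (hG' : IsMetricOn G' V') {Ψ : E → E'}
    {c X : F → E} {x : F} (hy : c x ∈ V) (hy' : Ψ (c x) ∈ V') (hΨ : ContDiffAt ℝ ∞ Ψ (c x))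
    (hpull : ∀ᶠ z in 𝓝 (c x), ∀ u v, G z u v = G' (Ψ z) (fderiv ℝ Ψ z u) (fderiv ℝ Ψ z v))
    (hsurj : Function.Surjective (fderiv ℝ Ψ (c x))) (hc : DifferentiableAt ℝ c x)
    (hX : DifferentiableAt ℝ X x) (v : F) :
    alongDeriv G' (fun z ↦ Ψ (c z)) (fun z ↦ fderiv ℝ Ψ (c z) (X z)) x v
      = fderiv ℝ Ψ (c x) (alongDeriv G c X x v) := by
  have hΨ1 := (hΨ.differentiableAt (by simp)).hasFDerivAt
  have hΨ2 := ((hΨ.fderiv_right (m := ∞) (by simp)).differentiableAt (by simp)).hasFDerivAt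
  have h1 : fderiv ℝ (fun z ↦ Ψ (c z)) x = _ := (hΨ1.comp x hc.hasFDerivAt).fderiv
  have h2 : fderiv ℝ (fun z ↦ fderiv ℝ Ψ (c z) (X z)) x = _ :=
    ((hΨ2.comp x hc.hasFDerivAt).clm_apply hX.hasFDerivAt).fderiv
  rw [alongDeriv_apply, alongDeriv_apply, h1, h2, map_add,
    fderiv_christoffel hG hG' hy hy' hΨ hpull hsurj]
  simp
  abel

end LocalGeom

/-! ### Coordinate expressions on manifolds -/

namespace FormField

section charts

variable {E M : Type*} [NormedAddCommGroup E] [NormedSpace ℝ E]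
  [TopologicalSpace M] [ChartedSpace E M] [IsManifold 𝓘(ℝ, E) ∞ M]
  {E' : Type*} [NormedAddCommGroup E'] [NormedSpace ℝ E']

omit [IsManifold 𝓘(ℝ, E) ∞ M] in
theorem isOpen_target (p : M) : IsOpen (extChartAt 𝓘(ℝ, E) p).target :=
  isOpen_extChartAt_target p

theorem contMDiffAt_chart {p q : M} (hq : q ∈ (extChartAt 𝓘(ℝ, E) p).source) :
    ContMDiffAt 𝓘(ℝ, E) 𝓘(ℝ, E) ∞ (extChartAt 𝓘(ℝ, E) p) q :=
  contMDiffAt_extChartAt' (by simpa using hq)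

theorem contMDiffAt_chart_symm {p : M} {y : E} (hy : y ∈ (extChartAt 𝓘(ℝ, E) p).target) :
    ContMDiffAt 𝓘(ℝ, E) 𝓘(ℝ, E) ∞ (extChartAt 𝓘(ℝ, E) p).symm y :=
  (contMDiffOn_extChartAt_symm p).contMDiffAt ((isOpen_target p).mem_nhds hy)

theorem mdifferentiableAt_chart {p q : M} (hq : q ∈ (extChartAt 𝓘(ℝ, E) p).source) :
    MDifferentiableAt 𝓘(ℝ, E) 𝓘(ℝ, E) (extChartAt 𝓘(ℝ, E) p) q :=
  (contMDiffAt_chart hq).mdifferentiableAt (by simp)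

theorem mdifferentiableAt_chart_symm {p : M} {y : E} (hy : y ∈ (extChartAt 𝓘(ℝ, E) p).target) :
    MDifferentiableAt 𝓘(ℝ, E) 𝓘(ℝ, E) (extChartAt 𝓘(ℝ, E) p).symm y :=
  (contMDiffAt_chart_symm hy).mdifferentiableAt (by simp)

theorem dChart_eq_id (p : M) : dChart E p = ContinuousLinearMap.id ℝ E :=
  mfderiv_extChartAt_self

theorem dChartAt_dChartSymm {p : M} {y : E} (hy : y ∈ (extChartAt 𝓘(ℝ, E) p).target) (v : E) :
    dChartAt E p ((extChartAt 𝓘(ℝ, E) p).symm y) (dChartSymm E p y v) = v := by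
  have := mfderiv_extChartAt_comp_mfderivWithin_extChartAt_symm hy
  simp only [modelWithCornersSelf_coe, Set.range_id, mfderivWithin_univ] at this
  exact congrArg (fun A : E →L[ℝ] E ↦ A v) this

theorem dChartSymm_dChartAt {p : M} {y : E} (hy : y ∈ (extChartAt 𝓘(ℝ, E) p).target)
    (v : TangentSpace 𝓘(ℝ, E) ((extChartAt 𝓘(ℝ, E) p).symm y)) :
    dChartSymm E p y (dChartAt E p ((extChartAt 𝓘(ℝ, E) p).symm y) v) = v := by
  have := mfderivWithin_extChartAt_symm_comp_mfderiv_extChartAt hy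
  simp only [modelWithCornersSelf_coe, Set.range_id, mfderivWithin_univ] at this
  exact congrArg (fun A : E →L[ℝ] E ↦ A v) this

theorem dChartAt_bijective {p q : M} (hq : q ∈ (extChartAt 𝓘(ℝ, E) p).source) :
    Function.Bijective (dChartAt E p q) :=
  (isInvertible_mfderiv_extChartAt hq).bijective

/-- A field of bilinear forms is recovered from its coordinate expression. -/
theorem inChart_dChartAt (B : FormField E M) {p q : M} (hq : q ∈ (extChartAt 𝓘(ℝ, E) p).source)
    (v w : TangentSpace 𝓘(ℝ, E) q) :
    B.inChart p (extChartAt 𝓘(ℝ, E) p q) (dChartAt E p q v) (dChartAt E p q w) = B q v w := by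
  obtain ⟨y, hy, rfl⟩ : ∃ y ∈ (extChartAt 𝓘(ℝ, E) p).target, q = (extChartAt 𝓘(ℝ, E) p).symm y :=
    ⟨_, (extChartAt 𝓘(ℝ, E) p).map_source hq, ((extChartAt 𝓘(ℝ, E) p).left_inv hq).symm⟩
  rw [(extChartAt 𝓘(ℝ, E) p).right_inv hy]
  change B _ (dChartSymm E p y _) (dChartSymm E p y _) = _
  rw [dChartSymm_dChartAt hy, dChartSymm_dChartAt hy]

/-- The chain rule for the coordinate expression of a function with values in a vector space. -/
theorem dVec_eq_fderiv {ψ : M → E'} {p q : M} (hq : q ∈ (extChartAt 𝓘(ℝ, E) p).source)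
    (hψ : MDifferentiableAt 𝓘(ℝ, E) 𝓘(ℝ, E') ψ q) (v : TangentSpace 𝓘(ℝ, E) q) :
    dVec ψ q v = fderiv ℝ (fun y ↦ ψ ((extChartAt 𝓘(ℝ, E) p).symm y)) (extChartAt 𝓘(ℝ, E) p q)
      (dChartAt E p q v) := by
  obtain ⟨y, hy, rfl⟩ : ∃ y ∈ (extChartAt 𝓘(ℝ, E) p).target, q = (extChartAt 𝓘(ℝ, E) p).symm y :=
    ⟨_, (extChartAt 𝓘(ℝ, E) p).map_source hq, ((extChartAt 𝓘(ℝ, E) p).left_inv hq).symm⟩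
  rw [(extChartAt 𝓘(ℝ, E) p).right_inv hy]
  have h1 := mfderiv_comp y hψ (mdifferentiableAt_chart_symm hy)
  rw [mfderiv_eq_fderiv] at h1
  change _ = fderiv ℝ (ψ ∘ (extChartAt 𝓘(ℝ, E) p).symm) y _
  rw [h1]
  change _ = dVec ψ _ (dChartSymm E p y _)
  rw [dChartSymm_dChartAt hy]

theorem fderiv_comp_symm {ψ : M → E'} {p : M} {y : E} (hy : y ∈ (extChartAt 𝓘(ℝ, E) p).target)
    (hψ : MDifferentiableAt 𝓘(ℝ, E) 𝓘(ℝ, E') ψ ((extChartAt 𝓘(ℝ, E) p).symm y)) (v : E) :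
    fderiv ℝ (fun y ↦ ψ ((extChartAt 𝓘(ℝ, E) p).symm y)) y v
      = dVec ψ ((extChartAt 𝓘(ℝ, E) p).symm y) (dChartSymm E p y v) := by
  rw [dVec_eq_fderiv ((extChartAt 𝓘(ℝ, E) p).map_target hy) hψ,
    (extChartAt 𝓘(ℝ, E) p).right_inv hy, dChartAt_dChartSymm hy]

theorem contDiffAt_comp_symm {ψ : M → E'} {p q : M} (hq : q ∈ (extChartAt 𝓘(ℝ, E) p).source)
    (hψ : ContMDiffAt 𝓘(ℝ, E) 𝓘(ℝ, E') ∞ ψ q) :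
    ContDiffAt ℝ ∞ (fun y ↦ ψ ((extChartAt 𝓘(ℝ, E) p).symm y)) (extChartAt 𝓘(ℝ, E) p q) := by
  have h1 := contMDiffAt_chart_symm ((extChartAt 𝓘(ℝ, E) p).map_source hq)
  have h2 : ContMDiffAt 𝓘(ℝ, E) 𝓘(ℝ, E') ∞ ψ
      ((extChartAt 𝓘(ℝ, E) p).symm (extChartAt 𝓘(ℝ, E) p q)) := by
    rwa [(extChartAt 𝓘(ℝ, E) p).left_inv hq]
  exact (h2.comp _ h1).contDiffAt

theorem contMDiffAt_of_comp_symm {ψ : M → E'} {p q : M}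
    (hq : q ∈ (extChartAt 𝓘(ℝ, E) p).source)
    (hψ : ContDiffAt ℝ ∞ (fun y ↦ ψ ((extChartAt 𝓘(ℝ, E) p).symm y)) (extChartAt 𝓘(ℝ, E) p q)) :
    ContMDiffAt 𝓘(ℝ, E) 𝓘(ℝ, E') ∞ ψ q := by
  refine (hψ.contMDiffAt.comp q (contMDiffAt_chart hq)).congr_of_eventuallyEq ?_
  filter_upwards [(isOpen_extChartAt_source p).mem_nhds hq] with r hr
  exact congrArg ψ ((extChartAt 𝓘(ℝ, E) p).left_inv hr).symm

theorem contMDiffAt_tangentMap {M' : Type*} [TopologicalSpace M']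
    [ChartedSpace E' M'] [IsManifold 𝓘(ℝ, E') ∞ M'] {f : M → M'} {O : Set M} (hO : IsOpen O)
    (hf : ContMDiffOn 𝓘(ℝ, E) 𝓘(ℝ, E') ∞ f O) {z : TangentBundle 𝓘(ℝ, E) M} (hz : z.1 ∈ O) :
    ContMDiffAt 𝓘(ℝ, E).tangent 𝓘(ℝ, E').tangent ∞ (tangentMap 𝓘(ℝ, E) 𝓘(ℝ, E') f) z := by
  have hnhds : Bundle.TotalSpace.proj ⁻¹' O ∈ 𝓝 z :=
    (hO.preimage (FiberBundle.continuous_proj E (TangentSpace 𝓘(ℝ, E)))).mem_nhds hz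
  refine ((hf.contMDiffOn_tangentMapWithin (m := ∞) (by simp)
    hO.uniqueMDiffOn).contMDiffAt hnhds).congr_of_eventuallyEq ?_
  filter_upwards [hnhds] with w hw
  rw [tangentMap, tangentMapWithin, mfderivWithin_of_isOpen hO hw]

theorem contMDiffAt_tangent_chart_symm {p : M} {y : E}
    (hy : y ∈ (extChartAt 𝓘(ℝ, E) p).target) (u : E) :
    ContMDiffAt 𝓘(ℝ, E) 𝓘(ℝ, E).tangent ∞
      (fun y ↦ (⟨(extChartAt 𝓘(ℝ, E) p).symm y, dChartSymm E p y u⟩ : TangentBundle 𝓘(ℝ, E) M))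
      y := by
  have h2 : ContMDiffAt 𝓘(ℝ, E) 𝓘(ℝ, E).tangent ∞
      (fun y ↦ (⟨y, u⟩ : TangentBundle 𝓘(ℝ, E) E)) y :=
    contMDiffAt_vectorSpace_iff_contDiffAt.2 contDiffAt_const
  exact (contMDiffAt_tangentMap (isOpen_target p) (contMDiffOn_extChartAt_symm p) hy).comp y h2

/-- The components of a smooth vector field along a map are smooth. -/
theorem contMDiffAt_dChartAt {F S : Type*} [NormedAddCommGroup F] [NormedSpace ℝ F]
    [TopologicalSpace S] [ChartedSpace F S] {f : S → M} {X : ∀ s, TangentSpace 𝓘(ℝ, E) (f s)}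
    {s : S} (hX : ContMDiffAt 𝓘(ℝ, F) 𝓘(ℝ, E).tangent ∞
      (fun s ↦ (⟨f s, X s⟩ : TangentBundle 𝓘(ℝ, E) M)) s) {p : M}
    (hs : f s ∈ (extChartAt 𝓘(ℝ, E) p).source) :
    ContMDiffAt 𝓘(ℝ, F) 𝓘(ℝ, E) ∞ (fun s ↦ dChartAt E p (f s) (X s)) s := by
  have h1 : ContMDiffOn 𝓘(ℝ, E) 𝓘(ℝ, E) ∞ (extChartAt 𝓘(ℝ, E) p) (extChartAt 𝓘(ℝ, E) p).source :=
    fun q hq ↦ (contMDiffAt_chart hq).contMDiffWithinAt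
  have h2 := (contMDiffAt_tangentMap (isOpen_extChartAt_source p) h1 (z := ⟨f s, X s⟩) hs).comp s hX
  exact (contMDiff_snd_tangentBundle_modelSpace E 𝓘(ℝ, E)).contMDiffAt.comp s h2

variable [FiniteDimensional ℝ E]

/-- The coordinate expression of a Lorentzian metric, in the chart at `p`. -/
theorem _root_.LorentzMetric.isMetricOn_inChart (g : LorentzMetric E M) (p : M) :
    LocalGeom.IsMetricOn (g.form.inChart p) (extChartAt 𝓘(ℝ, E) p).target where
  isOpen := isOpen_target p
  symm y hy u v := (g.lorentzian _).1 _ _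
  nondegenerate y hy := by
    refine BilinForm.isInvertible_of_nondegenerate fun v hv ↦ ?_
    have : dChartSymm E p y v = 0 := (g.lorentzian _).eq_zero fun w ↦ by
      have := hv (dChartAt E p _ w)
      change g.form _ (dChartSymm E p y v) (dChartSymm E p y _) = 0 at this
      rwa [dChartSymm_dChartAt hy] at this
    rw [← dChartAt_dChartSymm hy v, this, map_zero]
  contDiffOn := by
    refine contDiffOn_clm_apply.2 fun u ↦ contDiffOn_clm_apply.2 fun w y hy ↦ ?_
    have h1 : ContMDiffAt 𝓘(ℝ, E) (𝓘(ℝ, E).prod 𝓘(ℝ, E →L[ℝ] E →L[ℝ] ℝ)) ∞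
        (fun y ↦ Bundle.TotalSpace.mk' (E →L[ℝ] E →L[ℝ] ℝ)
          (E := fun p : M ↦ TangentSpace 𝓘(ℝ, E) p →L[ℝ] TangentSpace 𝓘(ℝ, E) p →L[ℝ] ℝ)
          ((extChartAt 𝓘(ℝ, E) p).symm y) (g.form ((extChartAt 𝓘(ℝ, E) p).symm y))) y :=
      g.contMDiff.contMDiffAt.comp y (contMDiffAt_chart_symm hy)
    have h2 := ContMDiffAt.clm_bundle_apply₂ (F₃ := ℝ) (E₃ := Bundle.Trivial M ℝ) h1
      (contMDiffAt_tangent_chart_symm hy u) (contMDiffAt_tangent_chart_symm hy w)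
    exact (Bundle.contMDiffAt_totalSpace.1 h2).2.contDiffAt.contDiffWithinAt

end charts

end FormField

/-! ### The covariant derivative along a map in arbitrary coordinates -/

namespace FormField

variable {E M F S : Type*} [NormedAddCommGroup E] [NormedSpace ℝ E]
  [TopologicalSpace M] [ChartedSpace E M] [IsManifold 𝓘(ℝ, E) ∞ M]
  [NormedAddCommGroup F] [NormedSpace ℝ F]
  [TopologicalSpace S] [ChartedSpace F S] [IsManifold 𝓘(ℝ, F) ∞ S]
  {E' : Type*} [NormedAddCommGroup E'] [NormedSpace ℝ E']

theorem eventually_dVec_eq_fderiv {ψ : M → E'} {p : M}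
    (hψ : ContMDiffAt 𝓘(ℝ, E) 𝓘(ℝ, E') ∞ ψ p) :
    ∀ᶠ q in 𝓝 p, ∀ v, dVec ψ q v = fderiv ℝ (fun y ↦ ψ ((extChartAt 𝓘(ℝ, E) p).symm y))
      (extChartAt 𝓘(ℝ, E) p q) (dChartAt E p q v) := by
  filter_upwards [extChartAt_source_mem_nhds (I := 𝓘(ℝ, E)) p,
    contMDiffAt_iff_contMDiffAt_nhds (n := 1) (by simp) |>.1 (hψ.of_le (by simp))] with q hq hψq v
    using dVec_eq_fderiv hq (hψq.mdifferentiableAt (by simp)) v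

omit [IsManifold 𝓘(ℝ, F) ∞ S] in
/-- The differential of a smooth map into a vector space, applied to a smooth vector field along a
map, is smooth. -/
theorem contMDiffAt_dVec {ψ : M → E'} {f : S → M} {X : ∀ s, TangentSpace 𝓘(ℝ, E) (f s)} {s : S}
    (hψ : ContMDiffAt 𝓘(ℝ, E) 𝓘(ℝ, E') ∞ ψ (f s))
    (hX : ContMDiffAt 𝓘(ℝ, F) 𝓘(ℝ, E).tangent ∞
      (fun s ↦ (⟨f s, X s⟩ : TangentBundle 𝓘(ℝ, E) M)) s) :
    ContMDiffAt 𝓘(ℝ, F) 𝓘(ℝ, E') ∞ (fun s ↦ dVec ψ (f s) (X s)) s := by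
  have hf : ContMDiffAt 𝓘(ℝ, F) 𝓘(ℝ, E) ∞ f s := (Bundle.contMDiffAt_totalSpace.1 hX).1
  have hp : f s ∈ (extChartAt 𝓘(ℝ, E) (f s)).source := mem_extChartAt_source _
  have h1 := (contMDiffAt_chart hp).comp s hf
  have h2 := contMDiffAt_dChartAt hX hp
  have h3 : ContDiffAt ℝ ∞ (fun z : E × E ↦
      fderiv ℝ (fun y ↦ ψ ((extChartAt 𝓘(ℝ, E) (f s)).symm y)) z.1 z.2)
      (extChartAt 𝓘(ℝ, E) (f s) (f s), dChartAt E (f s) (f s) (X s)) := by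
    have h4 := (contDiffAt_comp_symm hp hψ).fderiv_right (m := ∞) (by simp)
    exact (ContDiffAt.comp (extChartAt 𝓘(ℝ, E) (f s) (f s), dChartAt E (f s) (f s) (X s)) h4
      contDiffAt_fst).clm_apply contDiffAt_snd
  refine (h3.contMDiffAt.comp s (h1.prodMk_space h2)).congr_of_eventuallyEq ?_
  filter_upwards [hf.continuousAt.eventually (eventually_dVec_eq_fderiv hψ)] with s' hs'
    using hs' (X s')

/-- The covariant derivative along a map, in the charts at `s` and `f s`, which are those that
define it. -/
theorem covDerivAlong_eq_alongDeriv (g : FormField E M) {f : S → M}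
    {X : ∀ s, TangentSpace 𝓘(ℝ, E) (f s)} {s : S}
    (hX : ContMDiffAt 𝓘(ℝ, F) 𝓘(ℝ, E).tangent ∞
      (fun s ↦ (⟨f s, X s⟩ : TangentBundle 𝓘(ℝ, E) M)) s) (v : TangentSpace 𝓘(ℝ, F) s) :
    dChartAt E (f s) (f s) (g.covDerivAlong f X s v) = LocalGeom.alongDeriv (g.inChart (f s))
      (fun x ↦ extChartAt 𝓘(ℝ, E) (f s) (f ((extChartAt 𝓘(ℝ, F) s).symm x)))
      (fun x ↦ dChartAt E (f s) (f ((extChartAt 𝓘(ℝ, F) s).symm x))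
        (X ((extChartAt 𝓘(ℝ, F) s).symm x))) (extChartAt 𝓘(ℝ, F) s s) (dChartAt F s s v) := by
  have hf : ContMDiffAt 𝓘(ℝ, F) 𝓘(ℝ, E) ∞ f s := (Bundle.contMDiffAt_totalSpace.1 hX).1
  have hp : f s ∈ (extChartAt 𝓘(ℝ, E) (f s)).source := mem_extChartAt_source _
  have hs : s ∈ (extChartAt 𝓘(ℝ, F) s).source := mem_extChartAt_source _
  have h1 := dVec_eq_fderiv hs ((contMDiffAt_dChartAt hX hp).mdifferentiableAt (by simp)) v
  have h2 := dVec_eq_fderiv (ψ := fun s' ↦ extChartAt 𝓘(ℝ, E) (f s) (f s')) hs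
    (((contMDiffAt_chart hp).comp s hf).mdifferentiableAt (by simp)) v
  rw [LocalGeom.alongDeriv_apply, (extChartAt 𝓘(ℝ, F) s).left_inv hs, ← h1, ← h2]
  have h3 : ∀ e : E, dChart E (f s) ((dChart E (f s)).inverse e) = e :=
    (isInvertible_mfderiv_extChartAt hp).self_apply_inverse
  exact h3 _

variable [FiniteDimensional ℝ E]

/-- The covariant derivative along a map can be computed in any coordinates `ψ` on the target
manifold, with the coordinate expression `G'` of the metric, and in any chart of the source. It is
not required that `ψ` be a chart of the atlas: it may be the composition of an isometry with a chart
of another manifold. -/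
theorem dVec_covDerivAlong (g : LorentzMetric E M) {f : S → M}
    {X : ∀ s, TangentSpace 𝓘(ℝ, E) (f s)} {s s₀ : S}
    (hs : s ∈ (extChartAt 𝓘(ℝ, F) s₀).source)
    (hX : ContMDiffAt 𝓘(ℝ, F) 𝓘(ℝ, E).tangent ∞
      (fun s ↦ (⟨f s, X s⟩ : TangentBundle 𝓘(ℝ, E) M)) s)
    {ψ : M → E'} (hψ : ContMDiffAt 𝓘(ℝ, E) 𝓘(ℝ, E') ∞ ψ (f s))
    {G' : E' → E' →L[ℝ] E' →L[ℝ] ℝ} {V' : Set E'} (hG' : LocalGeom.IsMetricOn G' V')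
    (hV' : ψ (f s) ∈ V')
    (hpull : ∀ᶠ q in 𝓝 (f s), ∀ v w : TangentSpace 𝓘(ℝ, E) q,
      g.form q v w = G' (ψ q) (dVec ψ q v) (dVec ψ q w))
    (hsurj : Function.Surjective (dVec (F := E) ψ (f s))) (v : TangentSpace 𝓘(ℝ, F) s) :
    dVec ψ (f s) (g.form.covDerivAlong f X s v)
      = LocalGeom.alongDeriv G' (fun x ↦ ψ (f ((extChartAt 𝓘(ℝ, F) s₀).symm x)))
        (fun x ↦ dVec ψ (f ((extChartAt 𝓘(ℝ, F) s₀).symm x)) (X ((extChartAt 𝓘(ℝ, F) s₀).symm x)))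
        (extChartAt 𝓘(ℝ, F) s₀ s) (dChartAt F s₀ s v) := by
  have hf : ContMDiffAt 𝓘(ℝ, F) 𝓘(ℝ, E) ∞ f s := (Bundle.contMDiffAt_totalSpace.1 hX).1
  set φ := extChartAt 𝓘(ℝ, E) (f s) with hφ
  set σ := extChartAt 𝓘(ℝ, F) s with hσ
  set σ₀ := extChartAt 𝓘(ℝ, F) s₀ with hσ₀
  have hp : f s ∈ φ.source := mem_extChartAt_source _
  have hss : s ∈ σ.source := mem_extChartAt_source _
  have hinv : σ.symm (σ s) = s := σ.left_inv hss
  set Ψ : E → E' := fun y ↦ ψ (φ.symm y) with hΨdef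
  set c : F → E := fun x ↦ φ (f (σ.symm x)) with hcdef
  set Y : F → E := fun x ↦ dChartAt E (f s) (f (σ.symm x)) (X (σ.symm x)) with hYdef
  have hcx : c (σ s) = φ (f s) := by rw [hcdef]; simp only [hinv]
  have hΨ : ContDiffAt ℝ ∞ Ψ (c (σ s)) := by
    rw [hcx]; exact contDiffAt_comp_symm hp hψ
  have hΨc : Ψ (c (σ s)) = ψ (f s) := by
    rw [hcx]; exact congrArg ψ (φ.left_inv hp)
  have hdΨ := eventually_dVec_eq_fderiv hψ
  have hc : DifferentiableAt ℝ c (σ s) :=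
    (contDiffAt_comp_symm hss ((contMDiffAt_chart hp).comp s hf)).differentiableAt (by simp)
  have hY : DifferentiableAt ℝ Y (σ s) :=
    (contDiffAt_comp_symm hss (contMDiffAt_dChartAt hX hp)).differentiableAt (by simp)
  have hfσ : ContinuousAt (fun x ↦ f (σ.symm x)) (σ s) :=
    ContinuousAt.comp (by rw [hinv]; exact hf.continuousAt)
      (contMDiffAt_chart_symm (σ.map_source hss)).continuousAt
  have hsurj' : Function.Surjective (fderiv ℝ Ψ (c (σ s))) := by
    rw [hcx]
    intro e
    obtain ⟨w, rfl⟩ := hsurj e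
    exact ⟨_, (hdΨ.self_of_nhds w).symm⟩
  have hpull' : ∀ᶠ z in 𝓝 (c (σ s)), ∀ u w, g.form.inChart (f s) z u w
      = G' (Ψ z) (fderiv ℝ Ψ z u) (fderiv ℝ Ψ z w) := by
    rw [hcx]
    have hcont : Filter.Tendsto φ.symm (𝓝 (φ (f s))) (𝓝 (f s)) := by
      have := (contMDiffAt_chart_symm (φ.map_source hp)).continuousAt
      rwa [ContinuousAt, φ.left_inv hp] at this
    filter_upwards [(isOpen_target (f s)).mem_nhds (φ.map_source hp),
      hcont.eventually hpull, hcont.eventually hdΨ] with z hz hz1 hz2 u w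
    have h1 : ∀ u, fderiv ℝ Ψ z u = dVec ψ (φ.symm z) (dChartSymm E (f s) z u) := by
      intro u
      rw [hz2, φ.right_inv hz, dChartAt_dChartSymm hz]
    rw [h1, h1]
    exact hz1 _ _
  have hnat := LocalGeom.alongDeriv_naturality (g.isMetricOn_inChart (f s)) hG'
    (c := c) (X := Y) (x := σ s) (by rw [hcx]; exact φ.map_source hp) (by rwa [hΨc]) hΨ hpull'
    hsurj' hc hY (dChartAt F s s v)
  rw [hcx] at hnat
  have hlhs : dVec ψ (f s) (g.form.covDerivAlong f X s v) = fderiv ℝ Ψ (φ (f s))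
      (LocalGeom.alongDeriv (g.form.inChart (f s)) c Y (σ s) (dChartAt F s s v)) := by
    rw [hdΨ.self_of_nhds, covDerivAlong_eq_alongDeriv _ hX v]
  rw [hlhs, ← hnat]
  -- pass from the chart at `s` to the chart at `s₀`
  set τ : F → F := fun x ↦ σ₀ (σ.symm x) with hτ
  have hτs : τ (σ s) = σ₀ s := by rw [hτ]; simp only [hinv]
  have hsymm : Filter.Tendsto σ.symm (𝓝 (σ s)) (𝓝 s) := by
    have := (contMDiffAt_chart_symm (σ.map_source hss)).continuousAt
    rwa [ContinuousAt, hinv] at this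
  have hτd : DifferentiableAt ℝ τ (σ s) :=
    (contDiffAt_comp_symm hss (contMDiffAt_chart hs)).differentiableAt (by simp)
  have hτ' : fderiv ℝ τ (σ s) (dChartAt F s s v) = dChartAt F s₀ s v :=
    (dVec_eq_fderiv hss (mdifferentiableAt_chart hs) v).symm
  have hψf : DifferentiableAt ℝ (fun x ↦ ψ (f (σ₀.symm x))) (τ (σ s)) := by
    rw [hτs]
    exact (contDiffAt_comp_symm hs (hψ.comp s hf)).differentiableAt (by simp)
  have hψX : DifferentiableAt ℝ (fun x ↦ dVec ψ (f (σ₀.symm x)) (X (σ₀.symm x))) (τ (σ s)) := by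
    rw [hτs]
    exact (contDiffAt_comp_symm hs (contMDiffAt_dVec hψ hX)).differentiableAt (by simp)
  have hcomp := LocalGeom.alongDeriv_comp G' hψf hψX hτd (dChartAt F s s v)
  rw [hτ', hτs] at hcomp
  rw [← hcomp]
  congr 1
  have hev1 : ∀ᶠ x in 𝓝 (σ s), σ₀.symm (τ x) = σ.symm x := by
    filter_upwards [hsymm.eventually ((isOpen_extChartAt_source s₀).mem_nhds hs)] with x hx
      using σ₀.left_inv hx
  have hev2 : ∀ᶠ x in 𝓝 (σ s), f (σ.symm x) ∈ φ.source :=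
    hfσ.eventually_mem (by rw [hinv]; exact extChartAt_source_mem_nhds (I := 𝓘(ℝ, E)) (f s))
  have hev3 : ∀ᶠ x in 𝓝 (σ s), ∀ w, dVec ψ (f (σ.symm x)) w
      = fderiv ℝ Ψ (φ (f (σ.symm x))) (dChartAt E (f s) (f (σ.symm x)) w) := by
    have hfσ' : Filter.Tendsto (fun x ↦ f (σ.symm x)) (𝓝 (σ s)) (𝓝 (f s)) := by
      have := hfσ
      rwa [ContinuousAt, hinv] at this
    exact hfσ'.eventually hdΨ
  refine LocalGeom.alongDeriv_congr G' ?_ ?_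
  · filter_upwards [hev1, hev2] with x h1 h2
    rw [h1]
    exact congrArg ψ (φ.left_inv h2)
  · filter_upwards [hev1, hev3] with x h1 h3
    rw [h1, h3]

end FormField

/-! ### Curves in coordinates -/

namespace FormField

variable {E M : Type*} [NormedAddCommGroup E] [NormedSpace ℝ E]
  [TopologicalSpace M] [ChartedSpace E M] [IsManifold 𝓘(ℝ, E) ∞ M]

theorem dChartAt_velocity {γ : ℝ → M} {p : M} {t : ℝ}
    (hγ : MDifferentiableAt 𝓘(ℝ, ℝ) 𝓘(ℝ, E) γ t) (hp : γ t ∈ (extChartAt 𝓘(ℝ, E) p).source) :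
    dChartAt E p (γ t) (velocity E γ t) = deriv (fun r ↦ extChartAt 𝓘(ℝ, E) p (γ r)) t := by
  have h1 := mfderiv_comp t (mdifferentiableAt_chart hp) hγ
  rw [mfderiv_eq_fderiv] at h1
  exact (congrArg (fun A : ℝ →L[ℝ] E ↦ A 1) h1).symm

/-- Tangent vectors can be compared in a chart, without a cast between the tangent spaces at equal
points. -/
theorem tangentBundle_ext {p q q' : M} (hq : q ∈ (extChartAt 𝓘(ℝ, E) p).source) (hqq' : q = q')
    {v : TangentSpace 𝓘(ℝ, E) q} {v' : TangentSpace 𝓘(ℝ, E) q'}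
    (hv : dChartAt E p q v = dChartAt E p q' v') :
    (⟨q, v⟩ : TangentBundle 𝓘(ℝ, E) M) = ⟨q', v'⟩ := by
  subst hqq'
  rw [(dChartAt_bijective hq).injective hv]

/-- The acceleration of a curve, in the chart at an arbitrary point. -/
theorem dChartAt_covDerivAlong_velocity [FiniteDimensional ℝ E] (g : LorentzMetric E M)
    {γ : ℝ → M} {O : Set ℝ} (hO : IsOpen O) (hγ : ContMDiffOn 𝓘(ℝ, ℝ) 𝓘(ℝ, E) ∞ γ O) {p : M}
    {t : ℝ} (ht : t ∈ O) (hp : γ t ∈ (extChartAt 𝓘(ℝ, E) p).source) :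
    dChartAt E p (γ t) (g.form.covDerivAlong (F := ℝ) γ (velocity E γ) t (1 : ℝ))
      = LocalGeom.alongDeriv (g.form.inChart p) (fun r ↦ extChartAt 𝓘(ℝ, E) p (γ r))
        (deriv fun r ↦ extChartAt 𝓘(ℝ, E) p (γ r)) t 1 := by
  have hX : ContMDiffAt 𝓘(ℝ, ℝ) 𝓘(ℝ, E).tangent ∞
      (fun r ↦ (⟨γ r, velocity E γ r⟩ : TangentBundle 𝓘(ℝ, E) M)) t := by
    have h2 : ContMDiffAt 𝓘(ℝ, ℝ) 𝓘(ℝ, ℝ).tangent ∞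
        (fun y ↦ (⟨y, (1 : ℝ)⟩ : TangentBundle 𝓘(ℝ, ℝ) ℝ)) t :=
      contMDiffAt_vectorSpace_iff_contDiffAt.2 contDiffAt_const
    exact (contMDiffAt_tangentMap hO hγ ht).comp t h2
  have h1 := dVec_covDerivAlong g (s₀ := t) (mem_extChartAt_source t) hX (contMDiffAt_chart hp)
    (g.isMetricOn_inChart p) ((extChartAt 𝓘(ℝ, E) p).map_source hp)
    (by
      filter_upwards [(isOpen_extChartAt_source p).mem_nhds hp] with q hq v w
        using (inChart_dChartAt g.form hq v w).symm)
    (dChartAt_bijective hp).surjective (1 : ℝ)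
  have h2 : dChartAt ℝ t t (1 : ℝ) = (1 : ℝ) :=
    congrArg (fun A : ℝ →L[ℝ] ℝ ↦ A 1) (dChart_eq_id t)
  rw [h2] at h1
  simp only [extChartAt_model_space_eq_id, PartialEquiv.refl_coe, PartialEquiv.refl_symm, id] at h1
  refine h1.trans ?_
  have hγt : ContinuousAt γ t := (hγ.contMDiffAt (hO.mem_nhds ht)).continuousAt
  rw [LocalGeom.alongDeriv_congr _ (.refl _ _)]
  filter_upwards [hO.mem_nhds ht, hγt.eventually_mem ((isOpen_extChartAt_source p).mem_nhds hp)]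
    with r hr hpr
  exact dChartAt_velocity ((hγ.contMDiffAt (hO.mem_nhds hr)).mdifferentiableAt (by simp)) hpr

end FormField

/-! ### Timelike hypersurfaces in coordinates -/

namespace TimelikeWall

open FormField

variable {E M F S : Type*} [NormedAddCommGroup E] [NormedSpace ℝ E]
  [TopologicalSpace M] [ChartedSpace E M] [IsManifold 𝓘(ℝ, E) ∞ M]
  [NormedAddCommGroup F] [NormedSpace ℝ F]
  [TopologicalSpace S] [ChartedSpace F S] [IsManifold 𝓘(ℝ, F) ∞ S]
  {g : LorentzMetric E M} (W : TimelikeWall g F S)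

/-- The induced metric of the hypersurface. -/
abbrev h : FormField F S := g.form.pullback W.ι

/-- The second fundamental form of the hypersurface. -/
abbrev chi : FormField F S := g.form.secondFundamentalForm W.ι W.N

/-- The embedding in the charts at `s₀` and at its image. -/
def coordMap (s₀ : S) (x : F) : E :=
  extChartAt 𝓘(ℝ, E) (W.ι s₀) (W.ι ((extChartAt 𝓘(ℝ, F) s₀).symm x))

/-- The unit normal in the charts at `s₀` and at its image. -/
def coordNormal (s₀ : S) (x : F) : E :=
  dChartAt E (W.ι s₀) (W.ι ((extChartAt 𝓘(ℝ, F) s₀).symm x)) (W.N ((extChartAt 𝓘(ℝ, F) s₀).symm x))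

/-- The points of the hypersurface that lie both in the chart at `s₀` and in the chart of the
ambient space at its image. -/
def chartNhd (s₀ : S) : Set S :=
  (extChartAt 𝓘(ℝ, F) s₀).source ∩ W.ι ⁻¹' (extChartAt 𝓘(ℝ, E) (W.ι s₀)).source

/-- The coordinates of the points of `chartNhd`. -/
def coordDomain (s₀ : S) : Set F :=
  (extChartAt 𝓘(ℝ, F) s₀).target ∩ (extChartAt 𝓘(ℝ, F) s₀).symm ⁻¹' W.chartNhd s₀

omit [IsManifold 𝓘(ℝ, F) ∞ S] in
theorem mem_chartNhd_self (s : S) : s ∈ W.chartNhd s :=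
  ⟨mem_extChartAt_source s, mem_extChartAt_source (W.ι s)⟩

omit [IsManifold 𝓘(ℝ, F) ∞ S] in
theorem mem_coordDomain {s₀ s : S} (hs : s ∈ W.chartNhd s₀) :
    extChartAt 𝓘(ℝ, F) s₀ s ∈ W.coordDomain s₀ := by
  refine ⟨(extChartAt 𝓘(ℝ, F) s₀).map_source hs.1, ?_⟩
  rw [Set.mem_preimage, (extChartAt 𝓘(ℝ, F) s₀).left_inv hs.1]
  exact hs

omit [IsManifold 𝓘(ℝ, F) ∞ S] in
theorem coordMap_chart {s₀ s : S} (hs : s ∈ W.chartNhd s₀) :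
    W.coordMap s₀ (extChartAt 𝓘(ℝ, F) s₀ s) = extChartAt 𝓘(ℝ, E) (W.ι s₀) (W.ι s) := by
  rw [coordMap, (extChartAt 𝓘(ℝ, F) s₀).left_inv hs.1]

omit [IsManifold 𝓘(ℝ, F) ∞ S] in
theorem contMDiff_ι : ContMDiff 𝓘(ℝ, F) 𝓘(ℝ, E) ∞ W.ι :=
  fun s ↦ (Bundle.contMDiffAt_totalSpace.1 (W.smooth_N s)).1

variable [FiniteDimensional ℝ E]

omit [FiniteDimensional ℝ E] in
theorem fderiv_coordMap {s₀ s : S} (hs : s ∈ W.chartNhd s₀) (v : TangentSpace 𝓘(ℝ, F) s) :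
    fderiv ℝ (W.coordMap s₀) (extChartAt 𝓘(ℝ, F) s₀ s) (dChartAt F s₀ s v)
      = dChartAt E (W.ι s₀) (W.ι s) (mfderiv 𝓘(ℝ, F) 𝓘(ℝ, E) W.ι s v) := by
  have hι : MDifferentiableAt 𝓘(ℝ, F) 𝓘(ℝ, E) W.ι s :=
    (W.contMDiff_ι s).mdifferentiableAt (by simp)
  have hφ := mdifferentiableAt_chart (E := E) hs.2
  have h1 := dVec_eq_fderiv (ψ := fun s' ↦ extChartAt 𝓘(ℝ, E) (W.ι s₀) (W.ι s')) hs.1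
    (hφ.comp s hι) v
  have h2 := mfderiv_comp s hφ hι
  exact h1.symm.trans (congrArg (fun A : F →L[ℝ] E ↦ A v) h2)

omit [FiniteDimensional ℝ E] in
/-- The induced metric near `s₀`, in the charts at `s₀` and `W.ι s₀`. -/
theorem h_apply {s₀ s : S} (hs : s ∈ W.chartNhd s₀) (v w : TangentSpace 𝓘(ℝ, F) s) :
    W.h s v w = g.form.inChart (W.ι s₀) (W.coordMap s₀ (extChartAt 𝓘(ℝ, F) s₀ s))
      (fderiv ℝ (W.coordMap s₀) (extChartAt 𝓘(ℝ, F) s₀ s) (dChartAt F s₀ s v))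
      (fderiv ℝ (W.coordMap s₀) (extChartAt 𝓘(ℝ, F) s₀ s) (dChartAt F s₀ s w)) := by
  rw [W.fderiv_coordMap hs, W.fderiv_coordMap hs, W.coordMap_chart hs, inChart_dChartAt _ hs.2]
  rfl

/-- The second fundamental form near `s₀`, in the charts at `s₀` and `W.ι s₀`, while its definition
uses at each point `s` the charts at `s` and `W.ι s`. -/
theorem chi_apply {s₀ s : S} (hs : s ∈ W.chartNhd s₀) (v w : TangentSpace 𝓘(ℝ, F) s) :
    W.chi s v w = g.form.inChart (W.ι s₀) (W.coordMap s₀ (extChartAt 𝓘(ℝ, F) s₀ s))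
      (LocalGeom.alongDeriv (g.form.inChart (W.ι s₀)) (W.coordMap s₀) (W.coordNormal s₀)
        (extChartAt 𝓘(ℝ, F) s₀ s) (dChartAt F s₀ s v))
      (fderiv ℝ (W.coordMap s₀) (extChartAt 𝓘(ℝ, F) s₀ s) (dChartAt F s₀ s w)) := by
  have h1 := dVec_covDerivAlong g hs.1 (W.smooth_N s) (contMDiffAt_chart hs.2)
    (g.isMetricOn_inChart (W.ι s₀)) ((extChartAt 𝓘(ℝ, E) (W.ι s₀)).map_source hs.2)
    (by
      filter_upwards [(isOpen_extChartAt_source (W.ι s₀)).mem_nhds hs.2] with q hq v w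
        using (inChart_dChartAt g.form hq v w).symm)
    (dChartAt_bijective hs.2).surjective v
  have h2 : LocalGeom.alongDeriv (g.form.inChart (W.ι s₀)) (W.coordMap s₀) (W.coordNormal s₀)
      (extChartAt 𝓘(ℝ, F) s₀ s) (dChartAt F s₀ s v)
      = dChartAt E (W.ι s₀) (W.ι s) (g.form.covDerivAlong W.ι W.N s v) := h1.symm
  rw [h2, W.fderiv_coordMap hs, W.coordMap_chart hs, inChart_dChartAt _ hs.2]
  rfl

omit [IsManifold 𝓘(ℝ, F) ∞ S] [FiniteDimensional ℝ E] in
theorem isOpen_coordDomain (s₀ : S) : IsOpen (W.coordDomain s₀) := by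
  have h1 : IsOpen (W.chartNhd s₀) := (isOpen_extChartAt_source s₀).inter
    ((isOpen_extChartAt_source _).preimage W.contMDiff_ι.continuous)
  exact (continuousOn_extChartAt_symm s₀).isOpen_inter_preimage (isOpen_target s₀) h1

omit [IsManifold 𝓘(ℝ, F) ∞ S] [FiniteDimensional ℝ E] in
theorem exists_chart_eq {s₀ : S} {x : F} (hx : x ∈ W.coordDomain s₀) :
    ∃ s ∈ W.chartNhd s₀, extChartAt 𝓘(ℝ, F) s₀ s = x :=
  ⟨_, hx.2, (extChartAt 𝓘(ℝ, F) s₀).right_inv hx.1⟩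

theorem localHypersurface (s₀ : S) :
    LocalGeom.LocalHypersurface (g.form.inChart (W.ι s₀)) (extChartAt 𝓘(ℝ, E) (W.ι s₀)).target
      (W.coordMap s₀) (W.coordNormal s₀) (W.coordDomain s₀) where
  metric := g.isMetricOn_inChart _
  isOpen := W.isOpen_coordDomain s₀
  mapsTo x hx := (extChartAt 𝓘(ℝ, E) (W.ι s₀)).map_source hx.2.2
  contDiffOn x hx := by
    obtain ⟨s, hs, rfl⟩ := W.exists_chart_eq hx
    exact (contDiffAt_comp_symm (ψ := fun s' ↦ extChartAt 𝓘(ℝ, E) (W.ι s₀) (W.ι s')) hs.1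
      ((contMDiffAt_chart hs.2).comp s (W.contMDiff_ι s))).contDiffWithinAt
  contDiffOn_normal x hx := by
    obtain ⟨s, hs, rfl⟩ := W.exists_chart_eq hx
    exact (contDiffAt_comp_symm hs.1
      (contMDiffAt_dChartAt (W.smooth_N s) hs.2)).contDiffWithinAt
  codim := W.codim
  normal x hx v := by
    obtain ⟨s, hs, rfl⟩ := W.exists_chart_eq hx
    obtain ⟨v, rfl⟩ := (dChartAt_bijective hs.1).surjective v
    rw [W.fderiv_coordMap hs, W.coordMap_chart hs, coordNormal,
      (extChartAt 𝓘(ℝ, F) s₀).left_inv hs.1, inChart_dChartAt _ hs.2, W.normal_N]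
  unit x hx := by
    obtain ⟨s, hs, rfl⟩ := W.exists_chart_eq hx
    rw [W.coordMap_chart hs, coordNormal,
      (extChartAt 𝓘(ℝ, F) s₀).left_inv hs.1, inChart_dChartAt _ hs.2, W.unit_N]
  nondegenerate x hx v hv := by
    obtain ⟨s, hs, rfl⟩ := W.exists_chart_eq hx
    obtain ⟨v, rfl⟩ := (dChartAt_bijective hs.1).surjective v
    rw [(W.timelike s).eq_zero (v := v) fun w ↦ (W.h_apply hs v w).trans (hv _), map_zero]

theorem chi_symm (s : S) (v w : TangentSpace 𝓘(ℝ, F) s) : W.chi s v w = W.chi s w v := by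
  rw [W.chi_apply (W.mem_chartNhd_self s), W.chi_apply (W.mem_chartNhd_self s),
    (W.localHypersurface s).secondFundamentalForm_symm (W.mem_coordDomain (W.mem_chartNhd_self s))]

end TimelikeWall

/-! ### Photon surfaces and umbilicity -/

namespace TimelikeWall

open FormField

variable {E M F S : Type*} [NormedAddCommGroup E] [NormedSpace ℝ E] [FiniteDimensional ℝ E]
  [TopologicalSpace M] [ChartedSpace E M] [IsManifold 𝓘(ℝ, E) ∞ M]
  [NormedAddCommGroup F] [NormedSpace ℝ F] [FiniteDimensional ℝ F]
  [TopologicalSpace S] [ChartedSpace F S] [IsManifold 𝓘(ℝ, F) ∞ S]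
  {g : LorentzMetric E M} (W : TimelikeWall g F S)

/-- The second fundamental form of a photon surface vanishes on null vectors. -/
theorem chi_eq_zero_of_isPhotonSurface (hP : IsPhotonSurface (F := F) g.form W.ι) {s : S}
    {k : TangentSpace 𝓘(ℝ, F) s} (hk : k ≠ 0) (hnull : W.h s k k = 0) : W.chi s k k = 0 := by
  obtain ⟨ε, hε, γ, hgeo, hinit, hrange⟩ := hP.null_geodesics s k hk hnull
  have h0 : (0 : ℝ) ∈ Set.Ioo (-ε) ε := ⟨by linarith, hε⟩
  have hγ0 : γ 0 = W.ι s := congrArg (fun z : TangentBundle 𝓘(ℝ, E) M ↦ z.1) hinit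
  have hvel : dChartAt E (W.ι s) (γ 0) (velocity E γ 0)
      = dChartAt E (W.ι s) (W.ι s) (mfderiv 𝓘(ℝ, F) 𝓘(ℝ, E) W.ι s k) :=
    congrArg (fun z : TangentBundle 𝓘(ℝ, E) M ↦ dChartAt E (W.ι s) z.1 z.2) hinit
  have hs := W.mem_chartNhd_self s
  have hx := W.mem_coordDomain hs
  have hL := W.localHypersurface s
  have hp : γ 0 ∈ (extChartAt 𝓘(ℝ, E) (W.ι s)).source := by
    rw [hγ0]; exact mem_extChartAt_source _
  have hγ : ContMDiffAt 𝓘(ℝ, ℝ) 𝓘(ℝ, E) ∞ γ 0 := hgeo.smooth.contMDiffAt (isOpen_Ioo.mem_nhds h0)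
  -- lift `γ` to `S`; the lift is continuous because `ι` is an embedding, and smooth because `ι`
  -- has a smooth local retraction
  have : Nonempty S := ⟨s⟩
  choose! c hc using hrange
  have hcs : Filter.Tendsto c (𝓝 0) (𝓝 s) := by
    rw [W.embedding.isEmbedding.isInducing.tendsto_nhds_iff, ← hγ0]
    refine hγ.continuousAt.tendsto.congr' ?_
    filter_upwards [isOpen_Ioo.mem_nhds h0] with t ht using (hc t ht).symm
  obtain ⟨ρ, hρ, hρf⟩ := hL.exists_leftInverse hx
  set σ := extChartAt 𝓘(ℝ, F) s with hσ
  set φ := extChartAt 𝓘(ℝ, E) (W.ι s) with hφ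
  have hc0 : c 0 = s := W.embedding.isEmbedding.injective ((hc 0 h0).trans hγ0)
  have hev : ∀ᶠ t in 𝓝 (0 : ℝ), φ (γ t) = W.coordMap s (σ (c t)) := by
    filter_upwards [isOpen_Ioo.mem_nhds h0,
      hcs.eventually ((isOpen_extChartAt_source s).mem_nhds hs.1)] with t ht hct
    rw [coordMap, ← hσ, σ.left_inv hct, hc t ht]
  have hσc : Filter.Tendsto (fun t ↦ σ (c t)) (𝓝 0) (𝓝 (σ s)) :=
    (continuousAt_extChartAt s).tendsto.comp hcs
  have hsmooth : ContDiffAt ℝ ∞ (fun t ↦ σ (c t)) 0 := by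
    have h1 : ContDiffAt ℝ ∞ (fun t ↦ φ (γ t)) 0 :=
      ((contMDiffAt_chart hp).comp (0 : ℝ) hγ).contDiffAt
    have h2 : ContDiffAt ℝ ∞ ρ (φ (γ 0)) := by
      rwa [hγ0, ← W.coordMap_chart hs]
    refine (h2.comp (0 : ℝ) h1).congr_of_eventuallyEq ?_
    filter_upwards [hev, hσc.eventually hρf] with t ht1 ht2
    rw [Function.comp_apply, ht1, ht2]
  have hacc : LocalGeom.alongDeriv (g.form.inChart (W.ι s)) (fun r ↦ W.coordMap s (σ (c r)))
      (deriv fun r ↦ W.coordMap s (σ (c r))) 0 1 = 0 := by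
    have h1 := dChartAt_covDerivAlong_velocity g isOpen_Ioo hgeo.smooth h0 hp
    rw [hgeo.geodesic 0 h0, map_zero] at h1
    rw [h1]
    refine congrArg (fun A : ℝ →L[ℝ] E ↦ A 1) (LocalGeom.alongDeriv_congr _ ?_ ?_)
    · exact Filter.EventuallyEq.symm hev
    · exact Filter.EventuallyEq.symm (Filter.EventuallyEq.deriv hev)
  have hct : σ (c 0) ∈ W.coordDomain s := by rwa [hc0]
  have key := hL.secondFundamentalForm_eq_zero_of_geodesic hct hsmooth hacc
  have hder : deriv (fun t ↦ σ (c t)) 0 = dChartAt F s s k := by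
    have h1 : deriv (fun t ↦ W.coordMap s (σ (c t))) 0
        = fderiv ℝ (W.coordMap s) (σ (c 0)) (deriv (fun t ↦ σ (c t)) 0) := by
      have h2 : HasFDerivAt (W.coordMap s) (fderiv ℝ (W.coordMap s) (σ (c 0))) (σ (c 0)) :=
        (hL.differentiableAt hct).hasFDerivAt
      have h3 := (hsmooth.differentiableAt (by simp)).hasDerivAt
      exact (HasFDerivAt.comp_hasDerivAt (f := fun t ↦ σ (c t)) (0 : ℝ) h2 h3).deriv
    rw [← Filter.EventuallyEq.deriv_eq hev,
      ← dChartAt_velocity (hγ.mdifferentiableAt (by simp)) hp, hvel, ← W.fderiv_coordMap hs,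
      hc0] at h1
    rw [← hL.tangentProj_fderiv hx (dChartAt F s s k), h1, hL.tangentProj_fderiv hx]
  rw [W.chi_apply hs, ← hσ, ← hder, ← hc0]
  simpa only [hc0] using key

/-- A photon surface is umbilic. In dimension `finrank ℝ F = 1` there are no null vectors, and every
symmetric form is a multiple of the metric. -/
theorem exists_chi_eq_smul_of_isPhotonSurface (hP : IsPhotonSurface (F := F) g.form W.ι) (s : S) :
    ∃ lam : ℝ, W.chi s = lam • W.h s :=
  (W.timelike s).exists_eq_smul (W.chi_symm s) fun _ hk hnull ↦
    W.chi_eq_zero_of_isPhotonSurface hP hk hnull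

omit [FiniteDimensional ℝ F] in
/-- Umbilicity in coordinates. -/
theorem umbilic_coord {lam : S → ℝ} (hlam : ∀ s, W.chi s = lam s • W.h s) (s₀ : S) :
    ∀ x ∈ W.coordDomain s₀, ∀ v w,
      g.form.inChart (W.ι s₀) (W.coordMap s₀ x)
        (LocalGeom.alongDeriv (g.form.inChart (W.ι s₀)) (W.coordMap s₀) (W.coordNormal s₀) x v)
        (fderiv ℝ (W.coordMap s₀) x w)
      = lam ((extChartAt 𝓘(ℝ, F) s₀).symm x) * g.form.inChart (W.ι s₀) (W.coordMap s₀ x)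
        (fderiv ℝ (W.coordMap s₀) x v) (fderiv ℝ (W.coordMap s₀) x w) := by
  intro x hx v w
  obtain ⟨s, hs, rfl⟩ := W.exists_chart_eq hx
  obtain ⟨v, rfl⟩ := (dChartAt_bijective hs.1).surjective v
  obtain ⟨w, rfl⟩ := (dChartAt_bijective hs.1).surjective w
  rw [← W.chi_apply hs, ← W.h_apply hs, (extChartAt 𝓘(ℝ, F) s₀).left_inv hs.1, hlam]
  rfl

/-- An umbilic timelike hypersurface is a photon surface. -/
theorem isPhotonSurface_of_umbilic {lam : S → ℝ} (hlam : ∀ s, W.chi s = lam s • W.h s) :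
    IsPhotonSurface (F := F) g.form W.ι where
  immersion := W.embedding.isImmersion
  codim := W.codim
  nowhere_spacelike s := by
    obtain ⟨-, t, ht, -⟩ := W.timelike s
    refine ⟨t, ?_, ht.le⟩
    rintro rfl
    simp at ht
  null_geodesics s k hk hnull := by
    have hs := W.mem_chartNhd_self s
    rw [W.h_apply hs] at hnull
    obtain ⟨ε, hε, c, hc, hc0, hc0', hcgeo⟩ :=
      (W.localHypersurface s).exists_null_geodesic_of_umbilic (W.umbilic_coord hlam s)
        (W.mem_coordDomain hs) hnull
    set σ := extChartAt 𝓘(ℝ, F) s with hσ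
    set φ := extChartAt 𝓘(ℝ, E) (W.ι s) with hφ
    have h0 : (0 : ℝ) ∈ Set.Ioo (-ε) ε := ⟨by linarith, hε⟩
    set γ : ℝ → M := fun t ↦ W.ι (σ.symm (c t)) with hγ
    have hmem : ∀ t ∈ Set.Ioo (-ε) ε, γ t ∈ φ.source := fun t ht ↦ (hcgeo t ht).1.2.2
    have hsmooth : ContMDiffOn 𝓘(ℝ, ℝ) 𝓘(ℝ, E) ∞ γ (Set.Ioo (-ε) ε) := by
      intro t ht
      have h1 : ContMDiffAt 𝓘(ℝ, ℝ) 𝓘(ℝ, F) ∞ c t :=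
        (hc.contDiffAt (isOpen_Ioo.mem_nhds ht)).contMDiffAt
      exact ((W.contMDiff_ι _).comp t
        ((contMDiffAt_chart_symm (hcgeo t ht).1.1).comp t h1)).contMDiffWithinAt
    have hdiff : ∀ t ∈ Set.Ioo (-ε) ε, MDifferentiableAt 𝓘(ℝ, ℝ) 𝓘(ℝ, E) γ t := fun t ht ↦
      (hsmooth.contMDiffAt (isOpen_Ioo.mem_nhds ht)).mdifferentiableAt (by simp)
    have hvel : ∀ t ∈ Set.Ioo (-ε) ε, dChartAt E (W.ι s) (γ t) (velocity E γ t)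
        = fderiv ℝ (W.coordMap s) (c t) (deriv c t) := by
      intro t ht
      rw [dChartAt_velocity (hdiff t ht) (hmem t ht)]
      exact (((W.localHypersurface s).differentiableAt (hcgeo t ht).1).hasFDerivAt.comp_hasDerivAt t
        ((hc.contDiffAt (isOpen_Ioo.mem_nhds ht)).differentiableAt (by simp)).hasDerivAt).deriv
    have hγ0 : γ 0 = W.ι s := by
      rw [hγ]; simp only [hc0]; rw [σ.left_inv hs.1]
    refine ⟨ε, hε, γ, ⟨hsmooth, fun t ht ↦ ?_, fun t ht ↦ ?_⟩, ?_, fun t _ ↦ ⟨_, rfl⟩⟩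
    · refine (dChartAt_bijective (hmem t ht)).injective ?_
      rw [dChartAt_covDerivAlong_velocity g isOpen_Ioo hsmooth ht (hmem t ht), map_zero]
      exact (hcgeo t ht).2.1
    · rw [← inChart_dChartAt g.form (hmem t ht), hvel t ht]
      exact (hcgeo t ht).2.2
    · refine tangentBundle_ext (hmem 0 h0) hγ0 ?_
      rw [hvel 0 h0, hc0, hc0', W.fderiv_coordMap hs]

/-! ### The mean curvature of umbilic hypersurfaces -/

omit [FiniteDimensional ℝ F] in
/-- Pointwise umbilicity determines a smooth factor, because every tangent space of a timelike
hypersurface has a timelike vector. -/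
theorem contMDiff_of_umbilic {lam : S → ℝ} (hlam : ∀ s, W.chi s = lam s • W.h s) :
    ContMDiff 𝓘(ℝ, F) 𝓘(ℝ, ℝ) ∞ lam := by
  intro s
  have hs := W.mem_chartNhd_self s
  obtain ⟨-, t, ht, -⟩ := W.timelike s
  have ht' : W.h s t t ≠ 0 := ht.ne
  rw [W.h_apply hs] at ht'
  exact contMDiffAt_of_comp_symm hs.1 ((W.localHypersurface s).contDiffAt_of_umbilic
    (W.umbilic_coord hlam s) (W.mem_coordDomain hs) ht')

/-- The principal curvature of an umbilic hypersurface is locally constant where the Ricci tensor is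
a multiple of the metric, by the Codazzi equation. -/
theorem fderiv_eq_zero_of_umbilic (hd : Module.finrank ℝ F ≠ 1) {lam : S → ℝ}
    (hlam : ∀ s, W.chi s = lam s • W.h s) {s : S} {Λ : ℝ}
    (hvac : g.form.einsteinTensor (W.ι s) + Λ • g.form (W.ι s) = 0) :
    fderiv ℝ (fun x ↦ lam ((extChartAt 𝓘(ℝ, F) s).symm x)) (extChartAt 𝓘(ℝ, F) s s) = 0 := by
  have hs := W.mem_chartNhd_self s
  have hx := W.mem_coordDomain hs
  have hL := W.localHypersurface s
  have hp : W.ι s ∈ (extChartAt 𝓘(ℝ, E) (W.ι s)).source := mem_extChartAt_source _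
  ext v
  have h1 := hL.ricci_normal_of_umbilic (W.umbilic_coord hlam s) hx
    ((contDiffAt_comp_symm hs.1 (W.contMDiff_of_umbilic hlam s)).differentiableAt (by simp)) v
  have h2 : ∀ a b : TangentSpace 𝓘(ℝ, E) (W.ι s), g.form (W.ι s) a b = 0 →
      LocalGeom.ricci (g.form.inChart (W.ι s)) (extChartAt 𝓘(ℝ, E) (W.ι s) (W.ι s))
        (dChartAt E (W.ι s) (W.ι s) a) (dChartAt E (W.ι s) (W.ι s) b) = 0 := by
    intro a b hab
    have h3 : g.form.einsteinTensor (W.ι s) a b + Λ * g.form (W.ι s) a b = 0 :=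
      congrArg (fun B : E →L[ℝ] E →L[ℝ] ℝ ↦ B a b) hvac
    have h4 : g.form.einsteinTensor (W.ι s) a b
      = LocalGeom.ricci (g.form.inChart (W.ι s)) (extChartAt 𝓘(ℝ, E) (W.ι s) (W.ι s))
          (dChartAt E (W.ι s) (W.ι s) a) (dChartAt E (W.ι s) (W.ι s) b)
        - _ / 2 * g.form.inChart (W.ι s) (extChartAt 𝓘(ℝ, E) (W.ι s) (W.ι s))
          (dChartAt E (W.ι s) (W.ι s) a) (dChartAt E (W.ι s) (W.ι s) b) := rfl
    rw [h4, inChart_dChartAt _ hp, hab] at h3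
    linarith
  obtain ⟨v', rfl⟩ := (dChartAt_bijective hs.1).surjective v
  have h5 : LocalGeom.ricci (g.form.inChart (W.ι s)) (W.coordMap s (extChartAt 𝓘(ℝ, F) s s))
      (fderiv ℝ (W.coordMap s) (extChartAt 𝓘(ℝ, F) s s) (dChartAt F s s v'))
      (W.coordNormal s (extChartAt 𝓘(ℝ, F) s s)) = 0 := by
    rw [W.fderiv_coordMap hs, W.coordMap_chart hs, coordNormal,
      (extChartAt 𝓘(ℝ, F) s).left_inv hs.1]
    refine h2 _ _ ?_
    rw [(g.lorentzian _).1, W.normal_N]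
  rw [h5] at h1
  have h6 : (1 - (Module.finrank ℝ F : ℝ)) ≠ 0 := by
    rw [sub_ne_zero]
    exact_mod_cast hd.symm
  exact (mul_eq_zero.1 h1.symm).resolve_left h6

end TimelikeWall

/-! ### Locally constant functions and the divergence of a pure tension -/

namespace FormField

variable {F S : Type*} [NormedAddCommGroup F] [NormedSpace ℝ F]
  [TopologicalSpace S] [ChartedSpace F S] [IsManifold 𝓘(ℝ, F) ∞ S]

theorem isLocallyConstant_of_fderiv_eq_zero {ρ : S → ℝ} (hρ : ContMDiff 𝓘(ℝ, F) 𝓘(ℝ, ℝ) ∞ ρ)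
    (h0 : ∀ s, fderiv ℝ (fun x ↦ ρ ((extChartAt 𝓘(ℝ, F) s).symm x))
      (extChartAt 𝓘(ℝ, F) s s) = 0) : IsLocallyConstant ρ := by
  refine (IsLocallyConstant.iff_eventually_eq ρ).2 fun s ↦ ?_
  set σ := extChartAt 𝓘(ℝ, F) s with hσ
  have hs : s ∈ σ.source := mem_extChartAt_source s
  have hdiff : ∀ s, MDifferentiableAt 𝓘(ℝ, F) 𝓘(ℝ, ℝ) ρ s := fun s ↦
    (hρ s).mdifferentiableAt (by simp)
  obtain ⟨r, hr, hball⟩ := Metric.isOpen_iff.1 (isOpen_target s) _ (σ.map_source hs)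
  have hfd : ∀ x ∈ σ.target, fderiv ℝ (fun x ↦ ρ (σ.symm x)) x = 0 := by
    intro x hx
    ext v
    rw [fderiv_comp_symm hx (hdiff _), dVec_eq_fderiv (mem_extChartAt_source _) (hdiff _), h0]
    rfl
  have hd : DifferentiableOn ℝ (fun x ↦ ρ (σ.symm x)) (Metric.ball (σ s) r) := fun x hx ↦ by
    have := contDiffAt_comp_symm (σ.map_target (hball hx)) (hρ _)
    rw [σ.right_inv (hball hx)] at this
    exact (this.differentiableAt (by simp)).differentiableWithinAt
  have hcont := (continuousAt_extChartAt (I := 𝓘(ℝ, F)) s).eventually_mem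
    (Metric.ball_mem_nhds _ hr)
  filter_upwards [hcont, (isOpen_extChartAt_source s).mem_nhds hs] with s' h1 h2
  have h3 := Metric.isOpen_ball.is_const_of_fderiv_eq_zero
    (convex_ball (σ s) r).isPreconnected hd (fun x hx ↦ hfd x (hball hx)) h1
    (Metric.mem_ball_self hr)
  simp only [σ.left_inv hs] at h3
  rw [← h3]
  exact congrArg ρ (σ.left_inv h2).symm

end FormField

namespace TimelikeWall

open FormField

variable {E M F S : Type*} [NormedAddCommGroup E] [NormedSpace ℝ E] [FiniteDimensional ℝ E]
  [TopologicalSpace M] [ChartedSpace E M] [IsManifold 𝓘(ℝ, E) ∞ M]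
  [NormedAddCommGroup F] [NormedSpace ℝ F] [FiniteDimensional ℝ F]
  [TopologicalSpace S] [ChartedSpace F S] [IsManifold 𝓘(ℝ, F) ∞ S]
  {g : LorentzMetric E M} (W : TimelikeWall g F S)

theorem isMetricOn_h (s₀ : S) :
    LocalGeom.IsMetricOn (FormField.inChart W.h s₀) (W.coordDomain s₀) := by
  have hL := W.localHypersurface s₀
  have key : ∀ x ∈ W.coordDomain s₀, ∀ v w, FormField.inChart W.h s₀ x v w
      = g.form.inChart (W.ι s₀) (W.coordMap s₀ x) (fderiv ℝ (W.coordMap s₀) x v)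
        (fderiv ℝ (W.coordMap s₀) x w) := by
    intro x hx v w
    have h1 := W.h_apply hx.2 (dChartSymm F s₀ x v) (dChartSymm F s₀ x w)
    rw [(extChartAt 𝓘(ℝ, F) s₀).right_inv hx.1, dChartAt_dChartSymm hx.1,
      dChartAt_dChartSymm hx.1] at h1
    exact h1
  refine ⟨hL.isOpen, ?_, fun x hx v w ↦ ?_, fun x hx ↦ ?_⟩
  · refine contDiffOn_clm_apply.2 fun v ↦ contDiffOn_clm_apply.2 fun w x hx ↦ ?_
    have h1 : ContDiffAt ℝ ∞ (fun z ↦ g.form.inChart (W.ι s₀) (W.coordMap s₀ z)) x :=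
      (hL.metric.contDiffAt (hL.mapsTo x hx)).comp x (hL.contDiffAt hx)
    have h2 := (h1.clm_apply ((hL.contDiffAt_fderiv hx).clm_apply
      (contDiffAt_const (c := v)))).clm_apply ((hL.contDiffAt_fderiv hx).clm_apply
      (contDiffAt_const (c := w)))
    refine (h2.congr_of_eventuallyEq ?_).contDiffWithinAt
    filter_upwards [hL.isOpen.mem_nhds hx] with z hz using key z hz v w
  · rw [key x hx, key x hx, hL.metric.symm _ (hL.mapsTo x hx)]
  · refine BilinForm.isInvertible_of_nondegenerate fun v hv ↦ ?_
    exact hL.nondegenerate x hx v fun w ↦ (key x hx v w).symm.trans (hv w)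

theorem divergence_smul_h {ρ : S → ℝ} (hρ : ContMDiff 𝓘(ℝ, F) 𝓘(ℝ, ℝ) ∞ ρ) (s : S)
    (a : TangentSpace 𝓘(ℝ, F) s) :
    FormField.divergence W.h (fun s ↦ ρ s • W.h s) s a
      = fderiv ℝ (fun x ↦ ρ ((extChartAt 𝓘(ℝ, F) s).symm x)) (extChartAt 𝓘(ℝ, F) s s)
        (dChart F s a) :=
  LocalGeom.divergence_smul (W.isMetricOn_h s) (W.mem_coordDomain (W.mem_chartNhd_self s))
    ((contDiffAt_comp_symm (mem_extChartAt_source s) (hρ s)).differentiableAt (by simp))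
    (.of_forall fun _ ↦ rfl) _

omit [FiniteDimensional ℝ E] [IsManifold 𝓘(ℝ, F) ∞ S] in
theorem metricTrace_smul_h (s : S) (c : ℝ) :
    BilinForm.metricTrace (W.h s) (c • W.h s) = c * Module.finrank ℝ F :=
  BilinForm.metricTrace_smul_self (V := F)
    (BilinForm.IsLorentzian.isInvertible (V := F) (W.timelike s)) c

end TimelikeWall

/-! ### Reflection symmetry -/

namespace JoinedSpacetime

open FormField

variable {E Mp Mm F S : Type*} [NormedAddCommGroup E] [NormedSpace ℝ E] [FiniteDimensional ℝ E]
  [TopologicalSpace Mp] [ChartedSpace E Mp] [IsManifold 𝓘(ℝ, E) ∞ Mp]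
  [TopologicalSpace Mm] [ChartedSpace E Mm] [IsManifold 𝓘(ℝ, E) ∞ Mm]
  {gp : LorentzMetric E Mp} {gm : LorentzMetric E Mm}
  [NormedAddCommGroup F] [NormedSpace ℝ F]
  [TopologicalSpace S] [ChartedSpace F S] [IsManifold 𝓘(ℝ, F) ∞ S]
  {J : JoinedSpacetime gp gm F S}

/-- The reflection preserves the induced metric and, as it reverses the normal, changes the sign of
the second fundamental form. -/
theorem IsZ2Symmetric.hPlus_eq_and_chiPlus_eq (hZ : J.IsZ2Symmetric) (s : S) :
    J.hPlus s = J.hMinus s ∧ J.chiPlus s = -J.chiMinus s := by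
  obtain ⟨Θ, hiso, hι, hN⟩ := hZ
  have hs := J.minus.mem_chartNhd_self s
  have hx := J.minus.mem_coordDomain hs
  set φ := extChartAt 𝓘(ℝ, E) (J.minus.ι s) with hφ
  set σ := extChartAt 𝓘(ℝ, F) s with hσ
  -- the chart at `Σ₋`, pulled back by the isometry, serves as coordinates near `Σ₊`
  set ψ : Mp → E := fun q ↦ φ (Θ q) with hψdef
  have hΘ : ∀ q, MDifferentiableAt 𝓘(ℝ, E) 𝓘(ℝ, E) Θ q := fun q ↦
    Θ.contMDiff.mdifferentiable (by simp) q
  have hchain : ∀ q, Θ q ∈ φ.source → ∀ v : TangentSpace 𝓘(ℝ, E) q,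
      dVec ψ q v = dChartAt E (J.minus.ι s) (Θ q) (mfderiv 𝓘(ℝ, E) 𝓘(ℝ, E) Θ q v) := fun q hq v ↦
    congrArg (fun A : E →L[ℝ] E ↦ A v) (mfderiv_comp q (mdifferentiableAt_chart hq) (hΘ q))
  have hp : Θ (J.plus.ι s) ∈ φ.source := by rw [hι]; exact hs.2
  have hψ : ContMDiffAt 𝓘(ℝ, E) 𝓘(ℝ, E) ∞ ψ (J.plus.ι s) :=
    (contMDiffAt_chart hp).comp _ (Θ.contMDiff _)
  have hpull : ∀ q, Θ q ∈ φ.source → ∀ v w : TangentSpace 𝓘(ℝ, E) q, gp.form q v w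
      = gm.form.inChart (J.minus.ι s) (ψ q) (dVec ψ q v) (dVec ψ q w) := by
    intro q hq v w
    rw [hchain q hq, hchain q hq, hψdef]
    simp only [hφ]
    rw [inChart_dChartAt _ hq, ← hiso q]
    rfl
  have hsurj : Function.Surjective (dVec (F := E) ψ (J.plus.ι s)) := by
    intro e
    obtain ⟨w, rfl⟩ := (dChartAt_bijective hp).surjective e
    obtain ⟨v, rfl⟩ := (Θ.mfderivToContinuousLinearEquiv (by simp) (J.plus.ι s)).surjective w
    exact ⟨v, hchain _ hp v⟩
  have hdι : ∀ v : TangentSpace 𝓘(ℝ, F) s,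
      dVec ψ (J.plus.ι s) (mfderiv 𝓘(ℝ, F) 𝓘(ℝ, E) J.plus.ι s v)
        = fderiv ℝ (J.minus.coordMap s) (σ s) (dChartAt F s s v) := by
    intro v
    have h1 : dVec (fun s' ↦ ψ (J.plus.ι s')) s v
        = dVec ψ (J.plus.ι s) (mfderiv 𝓘(ℝ, F) 𝓘(ℝ, E) J.plus.ι s v) :=
      congrArg (fun A : F →L[ℝ] E ↦ A v) (mfderiv_comp s (hψ.mdifferentiableAt (by simp))
        ((J.plus.contMDiff_ι s).mdifferentiableAt (by simp)))
    have h2 := dVec_eq_fderiv (ψ := fun s' ↦ ψ (J.plus.ι s')) hs.1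
      ((hψ.comp s (J.plus.contMDiff_ι s)).mdifferentiableAt (by simp)) v
    rw [← h1, h2]
    simp only [hψdef, hι]
    rfl
  have hψι : ψ (J.plus.ι s) = J.minus.coordMap s (σ s) := by
    rw [J.minus.coordMap_chart hs, hψdef]
    simp only [hι, hφ]
  have hcov : ∀ v : TangentSpace 𝓘(ℝ, F) s,
      dVec ψ (J.plus.ι s) (gp.form.covDerivAlong J.plus.ι J.plus.N s v)
        = -LocalGeom.alongDeriv (gm.form.inChart (J.minus.ι s)) (J.minus.coordMap s)
          (J.minus.coordNormal s) (σ s) (dChartAt F s s v) := by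
    intro v
    have hnear : ∀ᶠ q in 𝓝 (J.plus.ι s), Θ q ∈ φ.source :=
      Θ.contMDiff.continuous.continuousAt.eventually_mem
        ((isOpen_extChartAt_source _).mem_nhds hp)
    rw [dVec_covDerivAlong gp hs.1 (J.plus.smooth_N s) hψ (gm.isMetricOn_inChart _)
      (φ.map_source hp) (hnear.mono hpull) hsurj v]
    have h1 : (fun x ↦ ψ (J.plus.ι (σ.symm x))) = J.minus.coordMap s := by
      funext x
      simp only [hψdef, hι]
      rfl
    have h2 : (fun x ↦ dVec ψ (J.plus.ι (σ.symm x)) (J.plus.N (σ.symm x)))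
        =ᶠ[𝓝 (σ s)] fun x ↦ -J.minus.coordNormal s x := by
      filter_upwards [(J.minus.isOpen_coordDomain s).mem_nhds hx] with x hx'
      have h3 : Θ (J.plus.ι (σ.symm x)) ∈ φ.source := by rw [hι]; exact hx'.2.2
      rw [hchain _ h3]
      have h4 := congrArg (fun z : TangentBundle 𝓘(ℝ, E) Mm ↦ dChartAt E (J.minus.ι s) z.1 z.2)
        (hN (σ.symm x))
      refine h4.trans ?_
      exact map_neg (dChartAt E (J.minus.ι s) (J.minus.ι (σ.symm x))) _
    rw [h1, LocalGeom.alongDeriv_congr _ (.refl _ _) h2, LocalGeom.alongDeriv_apply,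
      LocalGeom.alongDeriv_apply, fderiv_fun_neg]
    simp
    abel
  constructor
  · refine ContinuousLinearMap.ext fun v ↦ ContinuousLinearMap.ext fun w ↦ ?_
    refine Eq.trans ?_ (J.minus.h_apply hs v w).symm
    rw [← hdι, ← hdι, ← hψι, ← hpull _ hp]
    rfl
  · refine ContinuousLinearMap.ext fun v ↦ ContinuousLinearMap.ext fun w ↦ ?_
    refine Eq.trans ?_ (congrArg Neg.neg (J.minus.chi_apply hs v w).symm)
    rw [← hdι w, ← hψι, ← neg_apply, ← map_neg, ← hcov, ← hpull _ hp]
    rfl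

end JoinedSpacetime

/-! ### Pure tension shells -/

namespace JoinedSpacetime

open FormField

variable {E Mp Mm F S : Type*} [NormedAddCommGroup E] [NormedSpace ℝ E] [FiniteDimensional ℝ E]
  [TopologicalSpace Mp] [ChartedSpace E Mp] [IsManifold 𝓘(ℝ, E) ∞ Mp]
  [TopologicalSpace Mm] [ChartedSpace E Mm] [IsManifold 𝓘(ℝ, E) ∞ Mm]
  {gp : LorentzMetric E Mp} {gm : LorentzMetric E Mm}
  [NormedAddCommGroup F] [NormedSpace ℝ F]
  [TopologicalSpace S] [ChartedSpace F S] [IsManifold 𝓘(ℝ, F) ∞ S]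
  {J : JoinedSpacetime gp gm F S} (hZ : J.IsZ2Symmetric)
include hZ

namespace IsZ2Symmetric

theorem shellMetric_eq : J.shellMetric = J.hPlus := by
  funext s
  change (1 / 2 : ℝ) • (J.hPlus s + J.hMinus s) = J.hPlus s
  rw [← (hZ.hPlus_eq_and_chiPlus_eq s).1, ← two_smul ℝ, smul_smul]
  norm_num

theorem chiMinus_eq (s : S) : J.chiMinus s = -J.chiPlus s := by
  rw [(hZ.hPlus_eq_and_chiPlus_eq s).2, neg_neg]

theorem shellMeanCurvature_eq_thetaPlus (s : S) : J.shellMeanCurvature s = J.thetaPlus s := by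
  rw [shellMeanCurvature, hZ.shellMetric_eq, thetaPlus]

theorem thetaMinus_eq (s : S) : J.thetaMinus s = -J.thetaPlus s := by
  rw [thetaMinus, hZ.chiMinus_eq, ← (hZ.hPlus_eq_and_chiPlus_eq s).1, thetaPlus]
  exact BilinForm.metricTrace_neg _ _

/-- The second junction condition for a reflection symmetric shell of tension `ε`. As `[χ] = 2χ₊`
and `[θ] = 2θ₊`, it says that the shell is umbilic, with a factor tied to `ε`. -/
theorem second_junction_iff (ε : ℝ) (s : S) :
    -(1 / (8 * Real.pi)) • ((J.chiPlus s - J.chiMinus s)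
      - (J.thetaPlus s - J.thetaMinus s) • J.shellMetric s) = -ε • J.shellMetric s
    ↔ J.chiPlus s = (J.thetaPlus s + 4 * Real.pi * ε) • J.hPlus s := by
  have hpi := Real.pi_pos.ne'
  rw [hZ.shellMetric_eq, hZ.chiMinus_eq, hZ.thetaMinus_eq]
  have key : ∀ v w : TangentSpace 𝓘(ℝ, F) s,
      (-(1 / (8 * Real.pi)) * ((J.chiPlus s v w - -J.chiPlus s v w)
        - (J.thetaPlus s - -J.thetaPlus s) * J.hPlus s v w) = -ε * J.hPlus s v w)
      ↔ J.chiPlus s v w = (J.thetaPlus s + 4 * Real.pi * ε) * J.hPlus s v w := by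
    intro v w
    constructor
    · intro h
      field_simp at h
      linarith
    · intro h
      rw [h]
      field_simp
      ring
  constructor
  · intro h
    exact ContinuousLinearMap.ext fun v ↦ ContinuousLinearMap.ext fun w ↦ (key v w).1
      (congrArg (fun B : F →L[ℝ] F →L[ℝ] ℝ ↦ B v w) h)
  · intro h
    exact ContinuousLinearMap.ext fun v ↦ ContinuousLinearMap.ext fun w ↦ (key v w).2
      (congrArg (fun B : F →L[ℝ] F →L[ℝ] ℝ ↦ B v w) h)

/-- The bulk stress energy tensors of a pure tension shell are multiples of the metric, so that
`T(·, N)` vanishes on the shell, and the equation of motion says that the tension has zero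
differential. -/
theorem shell_motion_iff [FiniteDimensional ℝ F] {ε : S → ℝ}
    (hε : ContMDiff 𝓘(ℝ, F) 𝓘(ℝ, ℝ) ∞ ε) (cp cm : ℝ) (s : S) :
    (∀ a : TangentSpace 𝓘(ℝ, F) s,
      J.shellMetric.divergence (fun s ↦ -ε s • J.shellMetric s) s a
        + ((cp • gp.form (J.plus.ι s)) (mfderiv 𝓘(ℝ, F) 𝓘(ℝ, E) J.plus.ι s a) (J.plus.N s)
          - (cm • gm.form (J.minus.ι s)) (mfderiv 𝓘(ℝ, F) 𝓘(ℝ, E) J.minus.ι s a)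
            (J.minus.N s)) = 0)
    ↔ fderiv ℝ (fun x ↦ ε ((extChartAt 𝓘(ℝ, F) s).symm x)) (extChartAt 𝓘(ℝ, F) s s) = 0 := by
  have hp : ∀ a : TangentSpace 𝓘(ℝ, F) s,
      gp.form (J.plus.ι s) (mfderiv 𝓘(ℝ, F) 𝓘(ℝ, E) J.plus.ι s a) (J.plus.N s) = 0 := fun a ↦ by
    rw [(gp.lorentzian _).1, J.plus.normal_N]
  have hm : ∀ a : TangentSpace 𝓘(ℝ, F) s,
      gm.form (J.minus.ι s) (mfderiv 𝓘(ℝ, F) 𝓘(ℝ, E) J.minus.ι s a) (J.minus.N s) = 0 :=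
    fun a ↦ by rw [(gm.lorentzian _).1, J.minus.normal_N]
  have hdiv : ∀ a : TangentSpace 𝓘(ℝ, F) s,
      J.shellMetric.divergence (fun s ↦ -ε s • J.shellMetric s) s a
        = -fderiv ℝ (fun x ↦ ε ((extChartAt 𝓘(ℝ, F) s).symm x)) (extChartAt 𝓘(ℝ, F) s s)
          (dChart F s a) := by
    intro a
    rw [hZ.shellMetric_eq]
    refine (J.plus.divergence_smul_h (ρ := fun s ↦ -ε s) hε.neg s a).trans ?_
    rw [fderiv_fun_neg]
    rfl
  constructor
  · intro h
    have h2 : ∀ a : TangentSpace 𝓘(ℝ, F) s,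
        -fderiv ℝ (fun x ↦ ε ((extChartAt 𝓘(ℝ, F) s).symm x)) (extChartAt 𝓘(ℝ, F) s s)
          (dChart F s a) = 0 := by
      intro a
      have h1 := h a
      rw [hdiv, smul_apply, smul_apply, smul_apply, smul_apply, hp, hm] at h1
      simpa using h1
    ext v
    obtain ⟨a, rfl⟩ := (dChartAt_bijective (mem_extChartAt_source s)).surjective v
    exact neg_eq_zero.1 (h2 a)
  · intro h a
    rw [hdiv, h, smul_apply, smul_apply, smul_apply, smul_apply, hp, hm]
    simp

variable [FiniteDimensional ℝ F]

omit hZ [FiniteDimensional ℝ E] [IsManifold 𝓘(ℝ, F) ∞ S] in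
theorem thetaPlus_eq_of_umbilic {s : S} {c : ℝ} (h : J.chiPlus s = c • J.hPlus s) :
    J.thetaPlus s = c * Module.finrank ℝ F := by
  rw [thetaPlus, h]
  exact J.plus.metricTrace_smul_h s c

end IsZ2Symmetric

variable [FiniteDimensional ℝ F]

omit hZ [FiniteDimensional ℝ F] [IsManifold 𝓘(ℝ, F) ∞ S] in
/-- The field equation with stress energy tensor `-Λ/(8π) g` is the vacuum equation with
cosmological constant `Λ`. -/
theorem einstein_iff_vacuum {M : Type*} [TopologicalSpace M] [ChartedSpace E M]
    (g : FormField E M) (U : Set M) (Λ : ℝ) :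
    EinsteinEquationOn g (fun p ↦ -(Λ / (8 * Real.pi)) • g p) U
      ↔ ∀ p ∈ U, g.einsteinTensor p + Λ • g p = 0 := by
  refine forall₂_congr fun p _ ↦ ?_
  have h1 : (8 * Real.pi) * -(Λ / (8 * Real.pi)) = -Λ := by
    have := Real.pi_pos.ne'
    field_simp
  rw [smul_smul, h1, neg_smul, eq_neg_iff_add_eq_zero]

omit [FiniteDimensional ℝ F] in
/-- The second fundamental form of a shell of tension `ε` is pure trace. -/
theorem IsZ2Symmetric.umbilic_of_isPureTensionalWith {ε : S → ℝ} (h : J.IsPureTensionalWith ε)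
    (s : S) : J.chiPlus s = (J.thetaPlus s + 4 * Real.pi * ε s) • J.hPlus s := by
  obtain ⟨-, Λp, Λm, hE⟩ := h
  exact (hZ.second_junction_iff (ε s) s).1 (hE.second_junction s)

/-- An umbilic shell between vacua is pure-tensional. The tension is the solution `ε` of
`lam = θ₊ + 4πε` with `θ₊ = d lam`. -/
theorem IsZ2Symmetric.isPureTensionalWith_of_umbilic (hF : 2 ≤ Module.finrank ℝ F)
    (hp : IsLambdaVacuumOn gp.form J.barPlus) (hm : IsLambdaVacuumOn gm.form J.barMinus)
    {lam : S → ℝ} (hlam : ∀ s, J.chiPlus s = lam s • J.hPlus s) :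
    J.IsPureTensionalWith fun s ↦ -((Module.finrank ℝ F : ℝ) - 1) / (4 * Real.pi) * lam s := by
  obtain ⟨Λp, hp⟩ := hp
  obtain ⟨Λm, hm⟩ := hm
  set c : ℝ := -((Module.finrank ℝ F : ℝ) - 1) / (4 * Real.pi) with hc
  have hlam_smooth : ContMDiff 𝓘(ℝ, F) 𝓘(ℝ, ℝ) ∞ lam := J.plus.contMDiff_of_umbilic hlam
  have hε : ContMDiff 𝓘(ℝ, F) 𝓘(ℝ, ℝ) ∞ (fun s ↦ c * lam s) :=
    (contDiff_const.mul contDiff_id).contMDiff.comp hlam_smooth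
  refine ⟨hε, Λp, Λm, (einstein_iff_vacuum _ _ _).2 hp, (einstein_iff_vacuum _ _ _).2 hm,
    fun s ↦ ?_, fun s ↦ ?_, fun s ↦ ?_⟩
  · rw [(hZ.hPlus_eq_and_chiPlus_eq s).1, sub_self]
  · refine (hZ.second_junction_iff (c * lam s) s).2 ?_
    rw [IsZ2Symmetric.thetaPlus_eq_of_umbilic (hlam s), hlam s]
    congr 1
    rw [hc]
    have := Real.pi_pos.ne'
    field_simp
    ring
  · refine (hZ.shell_motion_iff hε _ _ s).2 ?_
    -- the shell lies in the closed region `M̄₊`, where the field equation holds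
    have hs : J.plus.ι s ∈ J.barPlus := by
      have h1 : J.plus.ι s ∈ (J.plus.back ∪ J.plus.front)ᶜ := by
        rw [J.plus.compl_union]; exact ⟨s, rfl⟩
      exact fun h2 ↦ h1 (Or.inl h2)
    have h0 := J.plus.fderiv_eq_zero_of_umbilic (by omega) hlam (hp _ hs)
    have hd : DifferentiableAt ℝ (fun x ↦ lam ((extChartAt 𝓘(ℝ, F) s).symm x))
        (extChartAt 𝓘(ℝ, F) s s) :=
      (contDiffAt_comp_symm (mem_extChartAt_source s) (hlam_smooth s)).differentiableAt (by simp)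
    rw [fderiv_const_mul hd, h0, smul_zero]

end JoinedSpacetime

end

open JoinedSpacetime FormField in
theorem theorem1 {d : ℕ} (hd : 2 ≤ d)
    {E : Type*} [NormedAddCommGroup E] [NormedSpace ℝ E] [FiniteDimensional ℝ E]
    (hE : Module.finrank ℝ E = d + 1)
    {F : Type*} [NormedAddCommGroup F] [NormedSpace ℝ F] [FiniteDimensional ℝ F]
    (hF : Module.finrank ℝ F = d)
    {Mp : Type*} [TopologicalSpace Mp] [ChartedSpace E Mp] [IsManifold 𝓘(ℝ, E) ∞ Mp]
    {Mm : Type*} [TopologicalSpace Mm] [ChartedSpace E Mm] [IsManifold 𝓘(ℝ, E) ∞ Mm]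
    {S : Type*} [TopologicalSpace S] [ChartedSpace F S] [IsManifold 𝓘(ℝ, F) ∞ S]
    (gp : LorentzMetric E Mp) (gm : LorentzMetric E Mm)
    (J : JoinedSpacetime gp gm F S) (hZ : J.IsZ2Symmetric) :
    (J.IsPureTensional ↔
      (IsLambdaVacuumOn gp.form J.barPlus ∧ IsLambdaVacuumOn gm.form J.barMinus) ∧
      (IsPhotonSurface (F := F) gp.form J.plus.ι ∧ IsPhotonSurface (F := F) gm.form J.minus.ι)) ∧
    ∀ ε : S → ℝ, J.IsPureTensionalWith ε →
      (∀ s, ∀ s' ∈ connectedComponent s,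
        ε s' = ε s ∧ J.shellMeanCurvature s' = J.shellMeanCurvature s) ∧
      ∀ s, J.shellMeanCurvature s = J.thetaPlus s ∧
        J.shellMeanCurvature s = -J.thetaMinus s ∧
        J.shellMeanCurvature s = -(4 * Real.pi) * ((d : ℝ) / ((d : ℝ) - 1)) * ε s := by
  have hpi := Real.pi_pos.ne'
  have hF2 : 2 ≤ Module.finrank ℝ F := hF ▸ hd
  have hd1 : (d : ℝ) - 1 ≠ 0 := by
    have : (2 : ℝ) ≤ d := by exact_mod_cast hd
    linarith
  refine ⟨⟨?_, ?_⟩, fun ε hε ↦ ?_⟩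
  · rintro ⟨ε, hε⟩
    have hu := hZ.umbilic_of_isPureTensionalWith hε
    have hu' : ∀ s, J.chiMinus s = -(J.thetaPlus s + 4 * Real.pi * ε s) • J.hMinus s := fun s ↦ by
      rw [hZ.chiMinus_eq, hu, (hZ.hPlus_eq_and_chiPlus_eq s).1, neg_smul]
    obtain ⟨-, Λp, Λm, hE⟩ := hε
    exact ⟨⟨⟨Λp, (einstein_iff_vacuum _ _ _).1 hE.bulk_plus⟩,
      ⟨Λm, (einstein_iff_vacuum _ _ _).1 hE.bulk_minus⟩⟩,
      J.plus.isPhotonSurface_of_umbilic hu, J.minus.isPhotonSurface_of_umbilic hu'⟩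
  · rintro ⟨⟨hp, hm⟩, hP, -⟩
    choose lam hlam using J.plus.exists_chi_eq_smul_of_isPhotonSurface hP
    exact ⟨_, hZ.isPureTensionalWith_of_umbilic hF2 hp hm hlam⟩
  · have hθ : ∀ s, J.shellMeanCurvature s = -(4 * Real.pi) * ((d : ℝ) / ((d : ℝ) - 1)) * ε s := by
      intro s
      have h1 := IsZ2Symmetric.thetaPlus_eq_of_umbilic
        (hZ.umbilic_of_isPureTensionalWith hε s)
      -- `h1` reads `θ₊ = (θ₊ + 4πε) d`
      rw [hF] at h1
      rw [hZ.shellMeanCurvature_eq_thetaPlus]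
      field_simp
      linarith
    have hloc : IsLocallyConstant ε := by
      obtain ⟨hsmooth, Λp, Λm, hE⟩ := hε
      exact isLocallyConstant_of_fderiv_eq_zero hsmooth fun s ↦
        (hZ.shell_motion_iff hsmooth _ _ s).1 (hE.shell_motion s)
    refine ⟨fun s s' hs' ↦ ?_, fun s ↦ ⟨hZ.shellMeanCurvature_eq_thetaPlus s, ?_, hθ s⟩⟩
    · have h1 : ε s' = ε s :=
        hloc.apply_eq_of_isPreconnected isPreconnected_connectedComponent hs' mem_connectedComponent
      exact ⟨h1, by rw [hθ, hθ, h1]⟩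
    · rw [hZ.thetaMinus_eq, neg_neg, hZ.shellMeanCurvature_eq_thetaPlus]
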